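/- Let $F$ be a probability distribution supported in $[0,1]$, let $X,X_1,X_2,\dots$ be i.i.d. with law $F$, let $n\in\mathbb N=\{0,1,2,\dots\}$ and $0\le b\le a\le 1$. Consider the following two-player game $\Gamma_n^{FR}(a,b)$. Two items with values $a$ and $b$ are available at stage $0$; at each stage $t=1,\dots,n$ an item of value $X_t$ arrives and is observed by both players. At every stage $t<n$ each player still present, knowing all values that have arrived so far, all past bids and who obtained which item, chooses (simultaneously, possibly at random) either to pass or to bid for one of the items that have arrived and have not yet been taken. A player who is the only one to bid for an item gets it; if both bid for the same item, a fair coin decides who gets it, and the other player gets nothing at that stage. A player who gets an item leaves the market and his payoff is the value of that item. At stage $n$, a player who is alone takes the available item of highest value; if both players are present, they tie for it, and the loser of the fair coin toss gets the second highest available value. Strategies are measurable functions of the history, and each player maximizes his expected payoff. A profile is a subgame-perfect equilibrium (SPE) if it induces a Nash equilibrium in the continuation game after every history. Let $E_n^{FR}(a,b)\subset\mathbb R^2$ be the set of SPE payoff pairs, and $\mathrm PE_n^{FR}(a,b)$ its projection on the first coordinate. Then $E_n^{FR}(a,b)\subset\{(u,u):u\in[0,1]\}$. Furthermore $\mathrm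 PE_n^{FR}(a,b)$ has a minimum and a maximum, and $$\min \mathrm PE_n^{FR}(a,b)=l_n(a,b),\qquad \max \mathrm PE_n^{FR}(a,b)=h_n(a,b),$$ where $l_0(a,b)=h_0(a,b)=\frac{a+b}{2}$ and, for $n\ge 1$, with $X_{(n)}=\max\{X_1,\dots,X_n\}$, $\vee=\max$ and $\mathrm{med}$ the median of three numbers, $$l_n(a,b)=L\bigl(a,\ \mathbb E(X_{(n)}\vee b),\ \mathbb E[\,l_{n-1}(a\vee X,\mathrm{med}[a,b,X])\,]\bigr),$$ $$h_n(a,b)=H\bigl(a,\ \mathbb E(X_{(n)}\vee b),\ \mathbb E[\,h_{n-1}(a\vee X,\mathrm{med}[a,b,X])\,]\bigr),$$ $$L(x,y,z)=\begin{cases} z & \text{if } x<y,\\ \tfrac12(x+y) & \text{if } x\ge y,\end{cases}\qquad H(x,y,z)=\begin{cases}\tfrac12(x+y) & \text{if } x>y\vee z,\\ z & \text{if } x\le y\vee z.\end{cases}$$ -/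

import Mathlib

open MeasureTheory

namespace FullRecall

/-!
The competitive selection game with full recall.  Two players `0, 1 : Fin 2`; items are numbered
by `ℕ`: items `0` and `1` are the two values present at the beginning, item `t + 1` is the sample
arriving at stage `t ≥ 1`.  Thus the items that have appeared by stage `t` are those `j < t + 2`,
and their values form a vector `x : Fin (t + 2) → ℝ`.
-/

/-- What is publicly observed about the behaviour at one stage: what each player bid for and what
each player got (`none` is: no bid, respectively nothing obtained). -/
structure StageRecord where
  bid : Fin 2 → Option ℕ
  got : Fin 2 → Option ℕ

/-- The item obtained by player `i` in the past `r` (`none` if he is still in the market).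
Pasts are listed with the latest stage first. -/
def holding (r : List StageRecord) (i : Fin 2) : Option ℕ :=
  r.findSome? fun ρ => ρ.got i

/-- The items that have appeared by stage `t` and have not been selected. -/
def available (t : ℕ) (r : List StageRecord) : Finset ℕ :=
  (Finset.range (t + 2)).filter fun j => ∀ i, holding r i ≠ some j

/-- The pure actions of player `i` at stage `t`: `none` (pass) or bidding for an available item;
a player who has left the market has no choice. -/
def feasible (i : Fin 2) (t : ℕ) (r : List StageRecord) : Finset (Option ℕ) :=
  if holding r i = none then Finset.insertNone (available t r) else {none}

/-- The possible allocations after the bids `bid`.  If both players bid for the same item, either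
of them may get it (and the other one gets nothing); otherwise everyone gets what he bid for. -/
def allocations (bid : Fin 2 → Option ℕ) : Finset (Fin 2 → Option ℕ) :=
  if bid 0 = bid 1 ∧ bid 0 ≠ none then {![bid 0, none], ![none, bid 1]} else {bid}

/-- The pasts that are possible according to the rules of the game. -/
def IsPast : List StageRecord → Prop
  | [] => True
  | ρ :: r => IsPast r ∧ (∀ i, ρ.bid i ∈ feasible i r.length r) ∧ ρ.got ∈ allocations ρ.bid

/-- `(x, r)` is a history of the game with initial values `a` and `b` at stage `t`, when the
values of stage `t` have been observed and before the bids of stage `t`. -/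
structure IsHistory (a b : ℝ) (t : ℕ) (x : Fin (t + 2) → ℝ) (r : List StageRecord) : Prop where
  fst_eq : x 0 = a
  snd_eq : x 1 = b
  mem_Icc : ∀ j, x j ∈ Set.Icc (0 : ℝ) 1
  length_eq : r.length = t
  isPast : IsPast r

/-- A behaviour strategy of player `i`: after every history a probability distribution
over his feasible actions, depending measurably on the history (the behavioural part `r` of a
history ranges over a countable set). -/
structure Strategy (i : Fin 2) where
  act : (t : ℕ) → (Fin (t + 2) → ℝ) → List StageRecord → Option ℕ → ℝ
  measurable_act : ∀ t r α, Measurable fun x => act t x r α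
  act_nonneg : ∀ t x r α, 0 ≤ act t x r α
  act_eq_zero : ∀ t x r, ∀ α ∉ feasible i t r, act t x r α = 0
  sum_act : ∀ t x r, ∑ α ∈ feasible i t r, act t x r α = 1

/-- The value of item `j` at stage `t`. -/
def itemValue {t : ℕ} (x : Fin (t + 2) → ℝ) (j : ℕ) : ℝ :=
  if h : j < t + 2 then x ⟨j, h⟩ else 0

/-- An item of highest value in `S`. -/
noncomputable def bestItem (v : ℕ → ℝ) (S : Finset ℕ) : ℕ :=
  if h : S.Nonempty then Classical.choose (S.exists_max_image v h) else 0

/-- The highest value in `S`; getting nothing is worth `0`. -/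
noncomputable def bestValue (v : ℕ → ℝ) (S : Finset ℕ) : ℝ :=
  if S.Nonempty then v (bestItem v S) else 0

/-- The second highest value in `S` (counted with multiplicity). -/
noncomputable def secondValue (v : ℕ → ℝ) (S : Finset ℕ) : ℝ :=
  bestValue v (S.erase (bestItem v S))

/-- The expected payoff of player `i` at the last stage `t`, after its sample has been observed.
A player who left keeps his item; a player who is alone takes the best available item; if both
are present, they tie for the best available item and the loser takes the second best. -/
noncomputable def finalPayoff (t : ℕ) (x : Fin (t + 2) → ℝ) (r : List StageRecord)
    (i : Fin 2) : ℝ :=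
  match holding r i with
  | some j => itemValue x j
  | none =>
    if ∀ i', holding r i' = none then
      (bestValue (itemValue x) (available t r) + secondValue (itemValue x) (available t r)) / 2
    else bestValue (itemValue x) (available t r)

/-- The values known at the next stage, after the arrival of a sample with value `y`. -/
def addSample {t : ℕ} (x : Fin (t + 2) → ℝ) (y : ℝ) : Fin (t + 1 + 2) → ℝ :=
  Fin.snoc (α := fun _ => ℝ) x y

/-- The expected payoff of player `i` under the profile `σ` in the continuation game at stage `t`
after the history `(x, r)`, when `k` further samples with law `μ` are still to arrive.  The bids
are drawn independently from the mixed actions, ties are broken uniformly, and then the next sample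
arrives. -/
noncomputable def expectedPayoff (μ : Measure ℝ) (σ : (i : Fin 2) → Strategy i) :
    (k t : ℕ) → (Fin (t + 2) → ℝ) → List StageRecord → Fin 2 → ℝ
  | 0, t, x, r, i => finalPayoff t x r i
  | k + 1, t, x, r, i =>
    ∑ α ∈ feasible 0 t r, ∑ β ∈ feasible 1 t r,
      (σ 0).act t x r α * (σ 1).act t x r β *
        ((∑ g ∈ allocations ![α, β],
            ∫ y, expectedPayoff μ σ k (t + 1) (addSample x y) (⟨![α, β], g⟩ :: r) i ∂μ)
          / ((allocations ![α, β]).card : ℝ))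

/-- `σ` induces a Nash equilibrium of the continuation game after `(x, r)` with `k` further
samples to arrive. -/
def IsNashAfter (μ : Measure ℝ) (σ : (i : Fin 2) → Strategy i) (k t : ℕ)
    (x : Fin (t + 2) → ℝ) (r : List StageRecord) : Prop :=
  ∀ (i : Fin 2) (τ : Strategy i),
    expectedPayoff μ (Function.update σ i τ) k t x r i ≤ expectedPayoff μ σ k t x r i

/-- `σ` is a subgame-perfect equilibrium of the full recall game with `n` samples to arrive and
initial values `a` and `b`. -/
def IsSPE (μ : Measure ℝ) (n : ℕ) (a b : ℝ) (σ : (i : Fin 2) → Strategy i) : Prop :=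
  ∀ t ≤ n, ∀ (x : Fin (t + 2) → ℝ) (r : List StageRecord),
    IsHistory a b t x r → IsNashAfter μ σ (n - t) t x r

/-- The set of subgame-perfect equilibrium payoffs of the full recall game with `n` samples
to arrive and initial values `a` and `b`. -/
def spePayoffs (μ : Measure ℝ) (n : ℕ) (a b : ℝ) : Set (ℝ × ℝ) :=
  {p | ∃ σ : (i : Fin 2) → Strategy i, IsSPE μ n a b σ ∧
    p = (expectedPayoff μ σ n 0 ![a, b] [] 0, expectedPayoff μ σ n 0 ![a, b] [] 1)}

/-- The expectation of `max (X₁, …, Xₘ₊₁, b)` for independent `X₁, …, Xₘ₊₁` with law `μ`. -/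
noncomputable def expectedMax (μ : Measure ℝ) (m : ℕ) (b : ℝ) : ℝ :=
  ∫ ω : Fin (m + 1) → ℝ, max (Finset.univ.sup' Finset.univ_nonempty ω) b ∂(Measure.pi fun _ => μ)

/-- The median of three reals. -/
noncomputable def med (a b c : ℝ) : ℝ := max (min a b) (min (max a b) c)

noncomputable def L (x y z : ℝ) : ℝ := if x < y then z else (x + y) / 2

noncomputable def H (x y z : ℝ) : ℝ := if x ≤ max y z then z else (x + y) / 2

/-- The recursively defined lowest payoff `l_n(a, b)`. -/
noncomputable def low (μ : Measure ℝ) : ℕ → ℝ → ℝ → ℝ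
  | 0, a, b => (a + b) / 2
  | n + 1, a, b => L a (expectedMax μ n b) (∫ x, low μ n (max a x) (med a b x) ∂μ)

/-- The recursively defined highest payoff `h_n(a, b)`. -/
noncomputable def high (μ : Measure ℝ) : ℕ → ℝ → ℝ → ℝ
  | 0, a, b => (a + b) / 2
  | n + 1, a, b => H a (expectedMax μ n b) (∫ x, high μ n (max a x) (med a b x) ∂μ)

end FullRecall

set_option linter.unusedSectionVars false

namespace FullRecall

/-! ### Integration against a law carried by the unit interval. -/

section Integrals

variable {μ : Measure ℝ}

/-! Full recall makes a lone player's problem trivial. Passing never loses an item, so it is optimal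
to wait until the end. If the best available item is worth `c` and `k` samples are still to come,
this yields `waitValue μ k c`, the expected maximum of `c` and the samples. This function of `c` is
nondecreasing, 1-Lipschitz and at least `c`.

While both players are present nothing has been taken, so the relevant state is the pair `a ≥ b` of
the two highest values. After one player leaves, subgame perfection fixes the other's payoff
(`IsSPE.expectedPayoff_alone`), and one stage becomes a symmetric matrix game
(`IsSPE.bidPayoff_eq_stageGame`). Bidding alone for the best item gives `a`. Losing it gives `c`,
the waiting value from `b`. A tie gives `(a + c) / 2`, and two passes give the continuation payoff
`z`. The 1-Lipschitz property shows that a tie now is never better than a tie one stage later, hence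
`(a + c) / 2 ≤ z`.

This inequality determines the equilibria of the stage game (`stageGame_nash`). If `a < c`, bidding
is strictly dominated and the payoff is `z`. If `a > c`, only passing and bidding for the best item
survive. What remains is a coordination game, since passing becomes more attractive as the opponent
passes more, so its equilibria are symmetric. The payoff lies between `(a + c) / 2` and `z`, and
equals `(a + c) / 2` when `z < a`. The case `a = c` is degenerate and obeys the same bounds. By
backward induction payoffs are equal and lie between the two recursions
(`IsSPE.expectedPayoff_bounds`).

Both bounds are attained by symmetric pure profiles: both players pass on a region of states and
otherwise both bid for the best item. Such a profile is an equilibrium as soon as `a` is at most the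
continuation value where they pass, and `c ≤ a` where they bid (`isSPE_regionProfile`). `LowPass` is
the smallest region used, and `HighPass` also includes the states where joint waiting can be
sustained. -/

theorem ae_mem_Icc (hμ : μ (Set.Icc (0 : ℝ) 1)ᶜ = 0) : ∀ᵐ y ∂μ, y ∈ Set.Icc (0 : ℝ) 1 := by
  rw [ae_iff]; exact hμ

theorem measurable_integral_right [SFinite μ] {X : Type*} [MeasurableSpace X] {f : X → ℝ → ℝ}
    (hf : Measurable (Function.uncurry f)) : Measurable fun x => ∫ y, f x y ∂μ :=
  (hf.stronglyMeasurable.integral_prod_right).measurable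

theorem integral_mono_of_Icc (hμ : μ (Set.Icc (0 : ℝ) 1)ᶜ = 0) {f g : ℝ → ℝ}
    (hf : Integrable f μ) (hg : Integrable g μ)
    (h : ∀ y ∈ Set.Icc (0 : ℝ) 1, f y ≤ g y) : ∫ y, f y ∂μ ≤ ∫ y, g y ∂μ := by
  refine integral_mono_ae hf hg ?_
  filter_upwards [ae_mem_Icc hμ] with y hy using h y hy

theorem integral_congr_of_Icc (hμ : μ (Set.Icc (0 : ℝ) 1)ᶜ = 0) {f g : ℝ → ℝ}
    (h : ∀ y ∈ Set.Icc (0 : ℝ) 1, f y = g y) : ∫ y, f y ∂μ = ∫ y, g y ∂μ := by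
  refine integral_congr_ae ?_
  filter_upwards [ae_mem_Icc hμ] with y hy using h y hy

variable [IsProbabilityMeasure μ]

theorem integrable_of_mem_Icc (hμ : μ (Set.Icc (0 : ℝ) 1)ᶜ = 0) {f : ℝ → ℝ} (hf : Measurable f)
    (h : ∀ y ∈ Set.Icc (0 : ℝ) 1, f y ∈ Set.Icc (0 : ℝ) 1) : Integrable f μ := by
  refine Integrable.of_bound hf.aestronglyMeasurable 1 ?_
  filter_upwards [ae_mem_Icc hμ] with y hy
  rw [Real.norm_of_nonneg (h y hy).1]
  exact (h y hy).2

theorem integral_mem_Icc (hμ : μ (Set.Icc (0 : ℝ) 1)ᶜ = 0) {f : ℝ → ℝ} (hf : Measurable f)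
    (h : ∀ y ∈ Set.Icc (0 : ℝ) 1, f y ∈ Set.Icc (0 : ℝ) 1) :
    ∫ y, f y ∂μ ∈ Set.Icc (0 : ℝ) 1 := by
  have hi := integrable_of_mem_Icc hμ hf h
  constructor
  · simpa using integral_mono_of_Icc hμ (integrable_zero _ _ _) hi fun y hy => (h y hy).1
  · simpa using integral_mono_of_Icc hμ hi (integrable_const (1 : ℝ)) fun y hy => (h y hy).2

end Integrals

theorem max_mem_Icc {c d : ℝ} (hc : c ∈ Set.Icc (0 : ℝ) 1) (hd : d ∈ Set.Icc (0 : ℝ) 1) :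
    max c d ∈ Set.Icc (0 : ℝ) 1 :=
  ⟨le_max_of_le_left hc.1, max_le hc.2 hd.2⟩

theorem min_mem_Icc {c d : ℝ} (hc : c ∈ Set.Icc (0 : ℝ) 1) (hd : d ∈ Set.Icc (0 : ℝ) 1) :
    min c d ∈ Set.Icc (0 : ℝ) 1 :=
  ⟨le_min hc.1 hd.1, min_le_of_left_le hc.2⟩

/-! ### The value of waiting alone. -/

/-- The value of the best item for a player who is alone and waits until the end, when the best
available item has value `c` and `k` samples are still to arrive. -/
noncomputable def waitValue (μ : Measure ℝ) : ℕ → ℝ → ℝ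
  | 0, c => c
  | k + 1, c => ∫ y, waitValue μ k (max c y) ∂μ

section WaitValue

variable {μ : Measure ℝ} [IsProbabilityMeasure μ]

theorem measurable_waitValue (k : ℕ) : Measurable (waitValue μ k) := by
  induction k with
  | zero => exact measurable_id
  | succ k ih =>
    refine measurable_integral_right (f := fun c y => waitValue μ k (max c y)) ?_
    exact ih.comp (measurable_fst.max measurable_snd)

theorem waitValue_mem_Icc (hμ : μ (Set.Icc (0 : ℝ) 1)ᶜ = 0) (k : ℕ) {c : ℝ}
    (hc : c ∈ Set.Icc (0 : ℝ) 1) : waitValue μ k c ∈ Set.Icc (0 : ℝ) 1 := by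
  induction k generalizing c with
  | zero => exact hc
  | succ k ih =>
    exact integral_mem_Icc hμ ((measurable_waitValue k).comp (measurable_const.max measurable_id))
      fun y hy => ih (max_mem_Icc hc hy)

theorem integrable_waitValue (hμ : μ (Set.Icc (0 : ℝ) 1)ᶜ = 0) (k : ℕ) {c : ℝ}
    (hc : c ∈ Set.Icc (0 : ℝ) 1) : Integrable (fun y => waitValue μ k (max c y)) μ :=
  integrable_of_mem_Icc hμ ((measurable_waitValue k).comp (measurable_const.max measurable_id))
    fun _ hy => waitValue_mem_Icc hμ k (max_mem_Icc hc hy)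

theorem waitValue_mono (hμ : μ (Set.Icc (0 : ℝ) 1)ᶜ = 0) (k : ℕ) {c d : ℝ}
    (hc : c ∈ Set.Icc (0 : ℝ) 1) (hd : d ∈ Set.Icc (0 : ℝ) 1) (hcd : c ≤ d) :
    waitValue μ k c ≤ waitValue μ k d := by
  induction k generalizing c d with
  | zero => exact hcd
  | succ k ih =>
    exact integral_mono_of_Icc hμ (integrable_waitValue hμ k hc) (integrable_waitValue hμ k hd)
      fun y hy => ih (max_mem_Icc hc hy) (max_mem_Icc hd hy) (max_le_max_right y hcd)

/-- Taking a maximum with a sample cannot increase the gap between two values, and averaging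
preserves this. Every comparison of a tie now with a tie later rests on this 1-Lipschitz bound. -/
theorem waitValue_le_add (hμ : μ (Set.Icc (0 : ℝ) 1)ᶜ = 0) (k : ℕ) {c d : ℝ}
    (hc : c ∈ Set.Icc (0 : ℝ) 1) (hd : d ∈ Set.Icc (0 : ℝ) 1) (hcd : c ≤ d) :
    waitValue μ k d ≤ waitValue μ k c + (d - c) := by
  induction k generalizing c d with
  | zero => simp [waitValue]
  | succ k ih =>
    have h := integral_mono_of_Icc hμ (integrable_waitValue hμ k hd)
      ((integrable_waitValue hμ k hc).add (integrable_const (d - c)))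
      fun y hy => (ih (max_mem_Icc hc hy) (max_mem_Icc hd hy) (max_le_max_right y hcd)).trans
        (show _ ≤ waitValue μ k (max c y) + (d - c) by
          have : max d y - max c y ≤ d - c := by
            rcases max_cases d y with h | h <;> rcases max_cases c y with h' | h' <;> linarith
          linarith)
    rw [integral_add' (integrable_waitValue hμ k hc) (integrable_const _)] at h
    simpa [waitValue] using h

theorem le_waitValue (hμ : μ (Set.Icc (0 : ℝ) 1)ᶜ = 0) (k : ℕ) {c : ℝ}
    (hc : c ∈ Set.Icc (0 : ℝ) 1) : c ≤ waitValue μ k c := by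
  induction k generalizing c with
  | zero => exact le_rfl
  | succ k ih =>
    have h := integral_mono_of_Icc hμ (integrable_const c) (integrable_waitValue hμ k hc)
      fun y hy => (le_max_left c y).trans (ih (max_mem_Icc hc hy))
    simpa [waitValue] using h

theorem fold_max_mem_Icc {m : ℕ} {b : ℝ} (hb : b ∈ Set.Icc (0 : ℝ) 1) {ω : Fin m → ℝ}
    (hω : ∀ i, ω i ∈ Set.Icc (0 : ℝ) 1) (s : Finset (Fin m)) :
    s.fold max b ω ∈ Set.Icc (0 : ℝ) 1 := by
  induction s using Finset.induction_on with
  | empty => simpa using hb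
  | insert i s hi ih => rw [Finset.fold_insert hi]; exact max_mem_Icc (hω i) ih

theorem measurable_fold_max {m : ℕ} (b : ℝ) (s : Finset (Fin m)) :
    Measurable fun ω : Fin m → ℝ => s.fold max b ω := by
  induction s using Finset.induction_on with
  | empty => simp
  | insert i s hi ih =>
    simp only [Finset.fold_insert hi]
    exact (measurable_pi_apply i).max ih

theorem ae_pi_mem_Icc (hμ : μ (Set.Icc (0 : ℝ) 1)ᶜ = 0) (m : ℕ) :
    ∀ᵐ ω ∂(Measure.pi fun _ : Fin m => μ), ∀ i, ω i ∈ Set.Icc (0 : ℝ) 1 := by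
  rw [ae_all_iff]
  intro i
  exact (measurePreserving_eval (fun _ : Fin m => μ) i).quasiMeasurePreserving.ae (ae_mem_Icc hμ)

/-- The recursion absorbs one sample at a time into the starting value, so Fubini with the first
coordinate split off matches it. Using `fold` with initial value `b` lets the induction start at
zero samples, where a `sup'` would be undefined. -/
theorem integral_fold_max_eq_waitValue (hμ : μ (Set.Icc (0 : ℝ) 1)ᶜ = 0) (m : ℕ) {b : ℝ}
    (hb : b ∈ Set.Icc (0 : ℝ) 1) :
    ∫ ω : Fin m → ℝ, Finset.univ.fold max b ω ∂(Measure.pi fun _ => μ) = waitValue μ m b := by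
  induction m generalizing b with
  | zero => simp [waitValue]
  | succ m ih =>
    have e := (measurePreserving_piFinSuccAbove (fun _ : Fin (m + 1) => μ) 0).symm
    rw [← e.integral_comp' (g := fun ω => Finset.univ.fold max b ω), integral_prod]
    · refine integral_congr_of_Icc hμ fun y hy => ?_
      rw [← ih (max_mem_Icc hb hy)]
      refine integral_congr_ae (Filter.Eventually.of_forall fun ω => ?_)
      simp only [MeasurableEquiv.piFinSuccAbove_symm_apply, Fin.insertNthEquiv,
        Equiv.coe_fn_mk, Fin.insertNth_zero]
      rw [Fin.univ_succ, Finset.fold_cons, Finset.fold_map, max_comm b y]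
      have h : ∀ s : Finset (Fin m), max y (s.fold max b ω) = s.fold max (max y b) ω := by
        intro s
        induction s using Finset.induction_on with
        | empty => simp
        | insert i s hi ih => rw [Finset.fold_insert hi, Finset.fold_insert hi, ← ih, max_left_comm]
      simpa [Function.comp_def] using h Finset.univ
    · have hm := (measurable_fold_max b (Finset.univ : Finset (Fin (m + 1)))).comp e.measurable
      refine Integrable.of_bound hm.aestronglyMeasurable 1 ?_
      filter_upwards [e.quasiMeasurePreserving.ae (ae_pi_mem_Icc hμ (m + 1))] with ω hω
      have := fold_max_mem_Icc hb hω Finset.univ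
      rw [Real.norm_of_nonneg this.1]
      exact this.2

theorem expectedMax_eq_waitValue (hμ : μ (Set.Icc (0 : ℝ) 1)ᶜ = 0) (m : ℕ) {b : ℝ}
    (hb : b ∈ Set.Icc (0 : ℝ) 1) : expectedMax μ m b = waitValue μ (m + 1) b := by
  rw [← integral_fold_max_eq_waitValue hμ (m + 1) hb, expectedMax]
  congr 1
  ext ω
  refine eq_of_forall_ge_iff fun c => ?_
  simp [Finset.fold_max_le, and_comm]

end WaitValue

/-! ### Evolution of the two highest values, and values of pass-or-tie profiles. -/

theorem med_eq {a b : ℝ} (h : b ≤ a) (c : ℝ) : med a b c = max b (min a c) := by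
  simp [med, min_eq_right h, max_eq_left h]

theorem med_mem_Icc {a b c : ℝ} (ha : a ∈ Set.Icc (0 : ℝ) 1) (hb : b ∈ Set.Icc (0 : ℝ) 1)
    (hc : c ∈ Set.Icc (0 : ℝ) 1) : med a b c ∈ Set.Icc (0 : ℝ) 1 :=
  max_mem_Icc (min_mem_Icc ha hb) (min_mem_Icc (max_mem_Icc ha hb) hc)

theorem med_le_max {a b : ℝ} (h : b ≤ a) (c : ℝ) : med a b c ≤ max a c := by
  rw [med_eq h]
  exact max_le (h.trans (le_max_left _ _)) ((min_le_left _ _).trans (le_max_left _ _))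

theorem measurable_next : Measurable fun q : (ℝ × ℝ) × ℝ =>
    (max q.1.1 q.2, med q.1.1 q.1.2 q.2) := by
  unfold med
  fun_prop

/-- The value, for each of two players, when at each stage both pass if `pass` holds for the two
highest values, and otherwise both bid for the best item. -/
noncomputable def regionValue (μ : Measure ℝ) (pass : ℕ → ℝ → ℝ → Prop) : ℕ → ℝ → ℝ → ℝ
  | 0, a, b => (a + b) / 2
  | k + 1, a, b =>
    open Classical in
    if pass k a b then ∫ y, regionValue μ pass k (max a y) (med a b y) ∂μ
    else (a + waitValue μ (k + 1) b) / 2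

section RegionValue

variable {μ : Measure ℝ} [IsProbabilityMeasure μ] {pass : ℕ → ℝ → ℝ → Prop}

theorem measurable_regionValue (hp : ∀ k, MeasurableSet {q : ℝ × ℝ | pass k q.1 q.2}) (k : ℕ) :
    Measurable fun q : ℝ × ℝ => regionValue μ pass k q.1 q.2 := by
  classical
  induction k with
  | zero => simp only [regionValue]; fun_prop
  | succ k ih =>
    simp only [regionValue]
    refine Measurable.ite (hp k) ?_ ?_
    · exact measurable_integral_right
        (f := fun (q : ℝ × ℝ) y => regionValue μ pass k (max q.1 y) (med q.1 q.2 y))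
        (ih.comp measurable_next)
    · exact (measurable_fst.add ((measurable_waitValue (k + 1)).comp measurable_snd)).div_const 2

theorem measurable_regionValue_next (hp : ∀ k, MeasurableSet {q : ℝ × ℝ | pass k q.1 q.2}) (k : ℕ)
    (a b : ℝ) : Measurable fun y => regionValue μ pass k (max a y) (med a b y) :=
  (measurable_regionValue hp k).comp
    (measurable_next.comp (measurable_const (a := (a, b)).prodMk measurable_id))

theorem regionValue_mem_Icc (hμ : μ (Set.Icc (0 : ℝ) 1)ᶜ = 0)
    (hp : ∀ k, MeasurableSet {q : ℝ × ℝ | pass k q.1 q.2}) (k : ℕ) {a b : ℝ}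
    (ha : a ∈ Set.Icc (0 : ℝ) 1) (hb : b ∈ Set.Icc (0 : ℝ) 1) :
    regionValue μ pass k a b ∈ Set.Icc (0 : ℝ) 1 := by
  have avg : ∀ {c d : ℝ}, c ∈ Set.Icc (0 : ℝ) 1 → d ∈ Set.Icc (0 : ℝ) 1 →
      (c + d) / 2 ∈ Set.Icc (0 : ℝ) 1 := fun hc hd =>
    ⟨by linarith [hc.1, hd.1], by linarith [hc.2, hd.2]⟩
  induction k generalizing a b with
  | zero => exact avg ha hb
  | succ k ih =>
    simp only [regionValue]
    split_ifs
    · exact integral_mem_Icc hμ (measurable_regionValue_next hp k a b)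
        fun y hy => ih (max_mem_Icc ha hy) (med_mem_Icc ha hb hy)
    · exact avg ha (waitValue_mem_Icc hμ _ hb)

theorem integrable_regionValue (hμ : μ (Set.Icc (0 : ℝ) 1)ᶜ = 0)
    (hp : ∀ k, MeasurableSet {q : ℝ × ℝ | pass k q.1 q.2}) (k : ℕ) {a b : ℝ}
    (ha : a ∈ Set.Icc (0 : ℝ) 1) (hb : b ∈ Set.Icc (0 : ℝ) 1) :
    Integrable (fun y => regionValue μ pass k (max a y) (med a b y)) μ :=
  integrable_of_mem_Icc hμ (measurable_regionValue_next hp k a b)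
    fun _ hy => regionValue_mem_Icc hμ hp k (max_mem_Icc ha hy) (med_mem_Icc ha hb hy)

/-- If `y ≤ a`, both sides coincide. If `y ≥ a`, the claim reduces to `waitValue μ k y - waitValue μ
k a ≤ y - a`, the Lipschitz bound. -/
theorem add_waitValue_le_next (hμ : μ (Set.Icc (0 : ℝ) 1)ᶜ = 0) (k : ℕ) {a b y : ℝ}
    (ha : a ∈ Set.Icc (0 : ℝ) 1) (hba : b ≤ a)
    (hy : y ∈ Set.Icc (0 : ℝ) 1) :
    a + waitValue μ k (max b y) ≤ max a y + waitValue μ k (med a b y) := by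
  rw [med_eq hba]
  rcases le_total y a with h | h
  · rw [max_eq_left h, min_eq_right h]
  · rw [max_eq_right h, min_eq_left h, max_eq_right hba, max_eq_right (hba.trans h)]
    linarith [waitValue_le_add hμ k ha hy h]

/-- Delaying a tie by one stage never hurts: the preceding pointwise inequality is averaged over the
next sample. The function `f` stands for any continuation value that dominates the tie value of the
next stage. -/
theorem half_add_waitValue_le_integral (hμ : μ (Set.Icc (0 : ℝ) 1)ᶜ = 0) (k : ℕ) {a b : ℝ}
    (ha : a ∈ Set.Icc (0 : ℝ) 1) (hb : b ∈ Set.Icc (0 : ℝ) 1) (hba : b ≤ a) {f : ℝ → ℝ}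
    (hf : Integrable f μ)
    (h : ∀ y ∈ Set.Icc (0 : ℝ) 1, (max a y + waitValue μ k (med a b y)) / 2 ≤ f y) :
    (a + waitValue μ (k + 1) b) / 2 ≤ ∫ y, f y ∂μ := by
  have hi := integrable_waitValue hμ k hb
  have := integral_mono_of_Icc hμ (((integrable_const a).add hi).div_const 2) hf fun y hy =>
    show (a + waitValue μ k (max b y)) / 2 ≤ f y from
      le_trans (by linarith [add_waitValue_le_next hμ k ha hba hy]) (h y hy)
  rwa [integral_div, integral_add' (integrable_const a) hi, integral_const, probReal_univ,
    one_smul] at this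

theorem half_add_waitValue_le_regionValue (hμ : μ (Set.Icc (0 : ℝ) 1)ᶜ = 0)
    (hp : ∀ k, MeasurableSet {q : ℝ × ℝ | pass k q.1 q.2}) (k : ℕ) {a b : ℝ}
    (ha : a ∈ Set.Icc (0 : ℝ) 1) (hb : b ∈ Set.Icc (0 : ℝ) 1) (hba : b ≤ a) :
    (a + waitValue μ k b) / 2 ≤ regionValue μ pass k a b := by
  induction k generalizing a b with
  | zero => exact le_rfl
  | succ k ih =>
    simp only [regionValue]
    split_ifs
    · exact half_add_waitValue_le_integral hμ k ha hb hba (integrable_regionValue hμ hp k ha hb)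
        fun y hy => ih (max_mem_Icc ha hy) (med_mem_Icc ha hb hy) (med_le_max hba y)
    · exact le_rfl

/-- The region in which both players pass in the worst equilibrium. -/
def LowPass (μ : Measure ℝ) (k : ℕ) (a b : ℝ) : Prop := a < waitValue μ (k + 1) b

/-- The value `high`, with the expected maximum written as `waitValue`. -/
noncomputable def highValue (μ : Measure ℝ) : ℕ → ℝ → ℝ → ℝ
  | 0, a, b => (a + b) / 2
  | k + 1, a, b => H a (waitValue μ (k + 1) b) (∫ y, highValue μ k (max a y) (med a b y) ∂μ)

/-- The region in which both players pass in the best equilibrium. -/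
def HighPass (μ : Measure ℝ) (k : ℕ) (a b : ℝ) : Prop :=
  a ≤ max (waitValue μ (k + 1) b) (∫ y, highValue μ k (max a y) (med a b y) ∂μ)

theorem measurableSet_lowPass (k : ℕ) : MeasurableSet {q : ℝ × ℝ | LowPass μ k q.1 q.2} :=
  measurableSet_lt measurable_fst ((measurable_waitValue (k + 1)).comp measurable_snd)

/-- The pass region at `k` depends on the value at `k`, and the value at `k + 1` on that region. The
conditional form lets the measurability of the values be proved by induction. -/
theorem measurableSet_highPass_of {k : ℕ}
    (h : Measurable fun q : ℝ × ℝ => highValue μ k q.1 q.2) :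
    MeasurableSet {q : ℝ × ℝ | HighPass μ k q.1 q.2} :=
  measurableSet_le measurable_fst
    (((measurable_waitValue (k + 1)).comp measurable_snd).max
      (measurable_integral_right
        (f := fun (q : ℝ × ℝ) y => highValue μ k (max q.1 y) (med q.1 q.2 y))
        (h.comp measurable_next)))

theorem measurable_highValue (k : ℕ) : Measurable fun q : ℝ × ℝ => highValue μ k q.1 q.2 := by
  induction k with
  | zero => simp only [highValue]; fun_prop
  | succ k ih =>
    refine Measurable.ite (measurableSet_highPass_of ih) ?_ ?_
    · exact measurable_integral_right
        (f := fun (q : ℝ × ℝ) y => highValue μ k (max q.1 y) (med q.1 q.2 y))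
        (ih.comp measurable_next)
    · exact (measurable_fst.add ((measurable_waitValue (k + 1)).comp measurable_snd)).div_const 2

theorem measurableSet_highPass (k : ℕ) : MeasurableSet {q : ℝ × ℝ | HighPass μ k q.1 q.2} :=
  measurableSet_highPass_of (measurable_highValue k)

theorem regionValue_highPass (k : ℕ) (a b : ℝ) :
    regionValue μ (HighPass μ) k a b = highValue μ k a b := by
  induction k generalizing a b with
  | zero => rfl
  | succ k ih =>
    simp only [regionValue, highValue, H, ih, HighPass]

theorem highValue_eq_high (hμ : μ (Set.Icc (0 : ℝ) 1)ᶜ = 0) (k : ℕ) {a b : ℝ}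
    (ha : a ∈ Set.Icc (0 : ℝ) 1) (hb : b ∈ Set.Icc (0 : ℝ) 1) :
    highValue μ k a b = high μ k a b := by
  induction k generalizing a b with
  | zero => rfl
  | succ k ih =>
    rw [highValue, high, expectedMax_eq_waitValue hμ k hb, integral_congr_of_Icc hμ fun y hy =>
      ih (max_mem_Icc ha hy) (med_mem_Icc ha hb hy)]

theorem regionValue_lowPass_eq_low (hμ : μ (Set.Icc (0 : ℝ) 1)ᶜ = 0) (k : ℕ) {a b : ℝ}
    (ha : a ∈ Set.Icc (0 : ℝ) 1) (hb : b ∈ Set.Icc (0 : ℝ) 1) :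
    regionValue μ (LowPass μ) k a b = low μ k a b := by
  induction k generalizing a b with
  | zero => rfl
  | succ k ih =>
    rw [regionValue, low, expectedMax_eq_waitValue hμ k hb, L, integral_congr_of_Icc hμ fun y hy =>
      ih (max_mem_Icc ha hy) (med_mem_Icc ha hb hy)]
    simp only [LowPass]
    congr

theorem regionValue_highPass_eq_high (hμ : μ (Set.Icc (0 : ℝ) 1)ᶜ = 0) (k : ℕ) {a b : ℝ}
    (ha : a ∈ Set.Icc (0 : ℝ) 1) (hb : b ∈ Set.Icc (0 : ℝ) 1) :
    regionValue μ (HighPass μ) k a b = high μ k a b := by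
  rw [regionValue_highPass, highValue_eq_high hμ k ha hb]

end RegionValue

/-! ### The two highest values in a finite set of items. -/

section BestSecond

variable {v w : ℕ → ℝ} {S : Finset ℕ}

theorem bestItem_mem (v : ℕ → ℝ) (h : S.Nonempty) : bestItem v S ∈ S := by
  rw [bestItem, dif_pos h]
  exact (Classical.choose_spec (S.exists_max_image v h)).1

theorem le_bestItem {j : ℕ} (hj : j ∈ S) : v j ≤ v (bestItem v S) := by
  rw [bestItem, dif_pos ⟨j, hj⟩]
  exact (Classical.choose_spec (S.exists_max_image v ⟨j, hj⟩)).2 j hj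

theorem bestValue_eq {j : ℕ} (hj : j ∈ S) (h : ∀ l ∈ S, v l ≤ v j) : bestValue v S = v j := by
  rw [bestValue, if_pos ⟨j, hj⟩]
  exact le_antisymm (h _ (bestItem_mem v ⟨j, hj⟩)) (le_bestItem hj)

theorem exists_bestValue_eq (v : ℕ → ℝ) (h : S.Nonempty) :
    ∃ j ∈ S, v j = bestValue v S ∧ ∀ l ∈ S, v l ≤ v j := by
  refine ⟨bestItem v S, bestItem_mem v h, ?_, fun l hl => le_bestItem hl⟩
  rw [bestValue, if_pos h]

theorem le_bestValue {j : ℕ} (hj : j ∈ S) : v j ≤ bestValue v S := by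
  obtain ⟨i, -, h, h'⟩ := exists_bestValue_eq v ⟨j, hj⟩
  exact h ▸ h' j hj

theorem bestValue_empty (v : ℕ → ℝ) : bestValue v ∅ = 0 := by simp [bestValue]

theorem bestValue_congr (h : ∀ j ∈ S, v j = w j) : bestValue v S = bestValue w S := by
  rcases S.eq_empty_or_nonempty with rfl | hS
  · rw [bestValue_empty, bestValue_empty]
  · obtain ⟨j, hj, e, hm⟩ := exists_bestValue_eq w hS
    rw [← e, ← h j hj]
    exact bestValue_eq hj fun l hl => by rw [h l hl, h j hj]; exact hm l hl

theorem bestValue_mem_Icc (h : ∀ j, v j ∈ Set.Icc (0 : ℝ) 1) (S : Finset ℕ) :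
    bestValue v S ∈ Set.Icc (0 : ℝ) 1 := by
  unfold bestValue
  split_ifs
  · exact h _
  · simp

theorem secondValue_mem_Icc (h : ∀ j, v j ∈ Set.Icc (0 : ℝ) 1) (S : Finset ℕ) :
    secondValue v S ∈ Set.Icc (0 : ℝ) 1 :=
  bestValue_mem_Icc h _

theorem bestValue_mono (h : ∀ j, 0 ≤ v j) {S' : Finset ℕ} (hS : S ⊆ S') :
    bestValue v S ≤ bestValue v S' := by
  rcases S.eq_empty_or_nonempty with rfl | hn
  · rw [bestValue_empty, bestValue]
    split_ifs
    · exact h _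
    · exact le_rfl
  · obtain ⟨j, hj, e, -⟩ := exists_bestValue_eq v hn
    exact e ▸ le_bestValue (hS hj)

theorem bestValue_insert (h : ∀ j, 0 ≤ v j) (m : ℕ) (S : Finset ℕ) :
    bestValue v (insert m S) = max (bestValue v S) (v m) := by
  refine le_antisymm ?_ (max_le (bestValue_mono h (Finset.subset_insert m S))
    (le_bestValue (Finset.mem_insert_self m S)))
  obtain ⟨j, hj, e, -⟩ := exists_bestValue_eq v (Finset.insert_nonempty m S)
  rw [← e]
  rcases Finset.mem_insert.1 hj with rfl | hj
  · exact le_max_right _ _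
  · exact le_max_of_le_left (le_bestValue hj)

/-- The second value does not depend on which maximizer is removed: if two different ones exist,
each survives the removal of the other, so both remainders have the same maximum. -/
theorem secondValue_eq {j : ℕ} (hj : j ∈ S) (h : ∀ l ∈ S, v l ≤ v j) :
    secondValue v S = bestValue v (S.erase j) := by
  set i := bestItem v S with hi
  have hiS : i ∈ S := bestItem_mem v ⟨j, hj⟩
  have hle : ∀ l ∈ S, v l ≤ v i := fun l hl => le_bestItem hl
  rw [secondValue, ← hi]
  by_cases hij : i = j
  · rw [hij]
  · rw [bestValue_eq (Finset.mem_erase.2 ⟨Ne.symm hij, hj⟩)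
        fun l hl => h l (Finset.mem_of_mem_erase hl),
      bestValue_eq (Finset.mem_erase.2 ⟨hij, hiS⟩) fun l hl => hle l (Finset.mem_of_mem_erase hl)]
    exact le_antisymm (hle j hj) (h i hiS)

theorem secondValue_le_bestValue (h : ∀ j, 0 ≤ v j) (S : Finset ℕ) :
    secondValue v S ≤ bestValue v S :=
  bestValue_mono h (Finset.erase_subset _ _)

theorem secondValue_congr (h : ∀ j ∈ S, v j = w j) : secondValue v S = secondValue w S := by
  rcases S.eq_empty_or_nonempty with rfl | hS
  · simp [secondValue, bestValue_empty]
  · obtain ⟨j, hj, -, hm⟩ := exists_bestValue_eq w hS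
    rw [secondValue_eq hj hm, secondValue_eq (v := v) hj fun l hl => by
      rw [h l hl, h j hj]; exact hm l hl]
    exact bestValue_congr fun l hl => h l (Finset.mem_of_mem_erase hl)

theorem secondValue_insert (h : ∀ j, 0 ≤ v j) {m : ℕ} (hm : m ∉ S) (hS : S.Nonempty) :
    secondValue v (insert m S) = med (bestValue v S) (secondValue v S) (v m) := by
  rw [med_eq (secondValue_le_bestValue h S)]
  obtain ⟨j, hj, e, hmax⟩ := exists_bestValue_eq v hS
  have hjm : j ≠ m := fun h => hm (h ▸ hj)
  rcases le_total (v m) (v j) with hle | hle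
  · rw [secondValue_eq (Finset.mem_insert_of_mem hj) (Finset.forall_mem_insert _ _ _ |>.2
      ⟨hle, hmax⟩), Finset.erase_insert_of_ne hjm.symm, bestValue_insert h, secondValue_eq hj hmax,
      ← e, min_eq_right hle]
  · rw [secondValue_eq (Finset.mem_insert_self m S) (Finset.forall_mem_insert _ _ _ |>.2
      ⟨le_rfl, fun l hl => (hmax l hl).trans hle⟩), Finset.erase_insert hm, ← e,
      min_eq_left hle, e, max_eq_right (secondValue_le_bestValue h S)]

/-- Removing a non-maximal item leaves the maximum in place, so removing a maximizer minimizes what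
is left. This formula avoids the arbitrarily chosen `bestItem` and makes measurability accessible.
-/
theorem secondValue_eq_inf' (v : ℕ → ℝ) (hS : S.Nonempty) :
    secondValue v S = S.inf' hS fun j => bestValue v (S.erase j) := by
  obtain ⟨i, hi, -, hmax⟩ := exists_bestValue_eq v hS
  rw [secondValue_eq hi hmax]
  refine le_antisymm (Finset.le_inf' _ _ fun j hj => ?_) (Finset.inf'_le _ hi)
  by_cases hij : j = i
  · rw [hij]
  · have hne : (S.erase i).Nonempty := ⟨j, Finset.mem_erase.2 ⟨hij, hj⟩⟩
    obtain ⟨l, hl, e, -⟩ := exists_bestValue_eq v hne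
    rw [← e]
    exact (hmax l (Finset.mem_of_mem_erase hl)).trans
      (le_bestValue (Finset.mem_erase.2 ⟨Ne.symm hij, hi⟩))

theorem bestValue_eq_sup' (v : ℕ → ℝ) (hS : S.Nonempty) : bestValue v S = S.sup' hS v := by
  obtain ⟨i, hi, e, hmax⟩ := exists_bestValue_eq v hS
  rw [← e]
  exact le_antisymm (Finset.le_sup' v hi) (Finset.sup'_le _ _ hmax)

theorem measurable_bestValue {X : Type*} [MeasurableSpace X] {f : X → ℕ → ℝ}
    (hf : ∀ j, Measurable fun x => f x j) (S : Finset ℕ) :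
    Measurable fun x => bestValue (f x) S := by
  rcases S.eq_empty_or_nonempty with rfl | hS
  · simp [bestValue_empty]
  · simp only [bestValue_eq_sup' _ hS]
    convert Finset.measurable_sup' hS fun j _ => hf j using 1
    ext x
    simp

theorem measurable_secondValue {X : Type*} [MeasurableSpace X] {f : X → ℕ → ℝ}
    (hf : ∀ j, Measurable fun x => f x j) (S : Finset ℕ) :
    Measurable fun x => secondValue (f x) S := by
  rcases S.eq_empty_or_nonempty with rfl | hS
  · simp [secondValue, bestValue_empty]
  · simp only [secondValue_eq_inf' _ hS]
    convert Finset.inf'_induction hS (fun j x => bestValue (f x) (S.erase j)) (p := Measurable)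
      (fun _ h _ h' => h.inf h') fun j _ => measurable_bestValue hf (S.erase j) using 1
    ext x
    simp

end BestSecond

/-! ### Item values under the arrival of a sample. -/

section Items

variable {t : ℕ}

theorem itemValue_addSample_of_lt (x : Fin (t + 2) → ℝ) (y : ℝ) {j : ℕ} (hj : j < t + 2) :
    itemValue (addSample x y) j = itemValue x j := by
  have h : j < t + 1 + 2 := by omega
  rw [itemValue, dif_pos h, itemValue, dif_pos hj, addSample]
  exact Fin.snoc_castSucc (α := fun _ => ℝ) y x ⟨j, hj⟩

theorem itemValue_addSample_last (x : Fin (t + 2) → ℝ) (y : ℝ) :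
    itemValue (addSample x y) (t + 2) = y := by
  rw [itemValue, dif_pos (by omega), addSample]
  exact Fin.snoc_last (α := fun _ => ℝ) y x

theorem measurable_itemValue (j : ℕ) : Measurable fun x : Fin (t + 2) → ℝ => itemValue x j := by
  unfold itemValue
  split_ifs
  · exact measurable_pi_apply _
  · exact measurable_const

theorem itemValue_mem_Icc {x : Fin (t + 2) → ℝ} (hx : ∀ j, x j ∈ Set.Icc (0 : ℝ) 1) (j : ℕ) :
    itemValue x j ∈ Set.Icc (0 : ℝ) 1 := by
  unfold itemValue
  split_ifs
  · exact hx _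
  · simp

theorem addSample_mem_Icc {x : Fin (t + 2) → ℝ} (hx : ∀ j, x j ∈ Set.Icc (0 : ℝ) 1) {y : ℝ}
    (hy : y ∈ Set.Icc (0 : ℝ) 1) (j : Fin (t + 1 + 2)) :
    addSample x y j ∈ Set.Icc (0 : ℝ) 1 := by
  refine Fin.lastCases ?_ (fun j => ?_) j
  · rw [addSample, Fin.snoc_last]; exact hy
  · rw [addSample, Fin.snoc_castSucc]; exact hx j

theorem measurable_addSample :
    Measurable fun p : (Fin (t + 2) → ℝ) × ℝ => addSample p.1 p.2 := by
  refine measurable_pi_lambda _ fun j => ?_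
  refine Fin.lastCases ?_ (fun j => ?_) j
  · simp only [addSample, Fin.snoc_last]; exact measurable_snd
  · simp only [addSample, Fin.snoc_castSucc]; exact (measurable_pi_apply j).comp measurable_fst

/-- The highest and the second highest value observed by stage `t`. -/
noncomputable def topTwo (x : Fin (t + 2) → ℝ) : ℝ × ℝ :=
  (bestValue (itemValue x) (Finset.range (t + 2)), secondValue (itemValue x) (Finset.range (t + 2)))

theorem bestValue_addSample {x : Fin (t + 2) → ℝ} (hx : ∀ j, x j ∈ Set.Icc (0 : ℝ) 1) {y : ℝ}
    (hy : y ∈ Set.Icc (0 : ℝ) 1) {S : Finset ℕ} (hS : S ⊆ Finset.range (t + 2)) :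
    bestValue (itemValue (addSample x y)) (insert (t + 2) S) =
      max (bestValue (itemValue x) S) y := by
  rw [bestValue_insert fun j => (itemValue_mem_Icc (addSample_mem_Icc hx hy) j).1,
    itemValue_addSample_last, bestValue_congr fun j hj =>
      itemValue_addSample_of_lt x y (Finset.mem_range.1 (hS hj))]

theorem topTwo_addSample {x : Fin (t + 2) → ℝ} (hx : ∀ j, x j ∈ Set.Icc (0 : ℝ) 1) {y : ℝ}
    (hy : y ∈ Set.Icc (0 : ℝ) 1) :
    topTwo (addSample x y) = (max (topTwo x).1 y, med (topTwo x).1 (topTwo x).2 y) := by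
  have hlt : ∀ j ∈ Finset.range (t + 2), itemValue (addSample x y) j = itemValue x j :=
    fun j hj => itemValue_addSample_of_lt x y (Finset.mem_range.1 hj)
  have e : Finset.range (t + 1 + 2) = insert (t + 2) (Finset.range (t + 2)) :=
    Finset.range_add_one
  refine Prod.ext ?_ ?_
  · simp only [topTwo, e]
    exact bestValue_addSample hx hy subset_rfl
  · simp only [topTwo, e]
    rw [secondValue_insert (fun j => (itemValue_mem_Icc (addSample_mem_Icc hx hy) j).1) (by simp)
      ⟨0, by simp⟩, itemValue_addSample_last, bestValue_congr hlt, secondValue_congr hlt]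

theorem measurable_topTwo : Measurable fun x : Fin (t + 2) → ℝ => topTwo x :=
  (measurable_bestValue measurable_itemValue _).prodMk
    (measurable_secondValue measurable_itemValue _)

theorem topTwo_fst_mem_Icc {x : Fin (t + 2) → ℝ} (hx : ∀ j, x j ∈ Set.Icc (0 : ℝ) 1) :
    (topTwo x).1 ∈ Set.Icc (0 : ℝ) 1 :=
  bestValue_mem_Icc (itemValue_mem_Icc hx) _

theorem topTwo_snd_mem_Icc {x : Fin (t + 2) → ℝ} (hx : ∀ j, x j ∈ Set.Icc (0 : ℝ) 1) :
    (topTwo x).2 ∈ Set.Icc (0 : ℝ) 1 :=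
  secondValue_mem_Icc (itemValue_mem_Icc hx) _

theorem topTwo_snd_le_fst {x : Fin (t + 2) → ℝ} (hx : ∀ j, x j ∈ Set.Icc (0 : ℝ) 1) :
    (topTwo x).2 ≤ (topTwo x).1 :=
  secondValue_le_bestValue (fun j => (itemValue_mem_Icc hx j).1) _

theorem topTwo_initial {a b : ℝ} (hba : b ≤ a) : topTwo (t := 0) ![a, b] = (a, b) := by
  have h0 : itemValue (t := 0) ![a, b] 0 = a := rfl
  have h1 : itemValue (t := 0) ![a, b] 1 = b := rfl
  have hmax : ∀ l ∈ Finset.range 2, itemValue (t := 0) ![a, b] l ≤ itemValue (t := 0) ![a, b] 0 := by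
    intro l hl
    have : l = 0 ∨ l = 1 := by have := Finset.mem_range.1 hl; omega
    rcases this with rfl | rfl
    · exact le_rfl
    · rwa [h0, h1]
  refine Prod.ext ?_ ?_
  · exact bestValue_eq (by simp) hmax
  · refine (secondValue_eq (by simp) hmax).trans
      ((bestValue_eq (j := 1) (by simp) fun l hl => ?_).trans h1)
    have h := Finset.mem_erase.1 hl
    have : l = 1 := by have := Finset.mem_range.1 h.2; have := h.1; omega
    rw [this]

end Items

/-! ### Bids, allocations and histories seen from either player. -/

section Bids

/-- The pair of bids (or of allocated items) in which player `i` has `α` and his opponent `β`. -/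
def joint (i : Fin 2) (α β : Option ℕ) : Fin 2 → Option ℕ := fun i' => if i' = i then α else β

@[simp] theorem joint_self (i : Fin 2) (α β : Option ℕ) : joint i α β i = α := if_pos rfl

theorem joint_of_ne {i j : Fin 2} (h : i ≠ j) (α β : Option ℕ) : joint i α β j = β :=
  if_neg h.symm

theorem eq_of_ne_fin_two {i j : Fin 2} (h : i ≠ j) (l : Fin 2) : l = i ∨ l = j := by
  fin_cases i <;> fin_cases j <;> fin_cases l <;> simp at h ⊢

theorem forall_fin_two_iff {i j : Fin 2} (h : i ≠ j) {P : Fin 2 → Prop} :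
    (∀ l, P l) ↔ P i ∧ P j := by
  refine ⟨fun H => ⟨H i, H j⟩, fun H l => ?_⟩
  rcases eq_of_ne_fin_two h l with rfl | rfl
  · exact H.1
  · exact H.2

/-- This symmetry allows every later argument to be made once, for a player `i` and his opponent
`j`. -/
theorem joint_swap {i j : Fin 2} (h : i ≠ j) (α β : Option ℕ) : joint j β α = joint i α β := by
  refine funext ((forall_fin_two_iff h).2 ⟨?_, ?_⟩)
  · rw [joint_self, joint_of_ne h.symm]
  · rw [joint_self, joint_of_ne h]

theorem cons_eq_joint_zero (α β : Option ℕ) : ![α, β] = joint 0 α β := by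
  ext i : 1
  fin_cases i <;> rfl

theorem allocations_joint_of_not (i : Fin 2) {α β : Option ℕ} (h : ¬(α = β ∧ α ≠ none)) :
    allocations (joint i α β) = {joint i α β} := by
  rw [allocations, if_neg]
  fin_cases i
  · exact h
  · rintro ⟨h1, h2⟩
    exact h ⟨h1.symm, fun h' => h2 (h1.trans h')⟩

theorem allocations_joint_same (i : Fin 2) (l : ℕ) :
    allocations (joint i (some l) (some l)) = {joint i (some l) none, joint i none (some l)} := by
  rw [allocations, if_pos]
  · fin_cases i
    · simp [cons_eq_joint_zero, joint]
    · rw [cons_eq_joint_zero, cons_eq_joint_zero, Finset.pair_comm,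
        ← joint_swap (i := 0) (j := 1) (by decide), ← joint_swap (i := 0) (j := 1) (by decide)]
      rfl
  · simp [joint]

theorem holding_cons (ρ : StageRecord) (r : List StageRecord) (i : Fin 2) :
    holding (ρ :: r) i = (ρ.got i).or (holding r i) := by
  unfold holding
  rw [List.findSome?_cons]
  cases ρ.got i <;> rfl

theorem holding_cons_none (bid : Fin 2 → Option ℕ) (i : Fin 2) (r : List StageRecord) :
    holding (⟨bid, joint i none none⟩ :: r) = holding r := by
  funext l
  simp [holding_cons, joint]

theorem available_subset (t : ℕ) (r : List StageRecord) :
    available t r ⊆ Finset.range (t + 2) :=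
  Finset.filter_subset _ _

theorem none_mem_feasible (i : Fin 2) (t : ℕ) (r : List StageRecord) : none ∈ feasible i t r := by
  unfold feasible
  split_ifs <;> simp

theorem feasible_of_ne_none {i : Fin 2} {t : ℕ} {r : List StageRecord} (h : holding r i ≠ none) :
    feasible i t r = {none} :=
  if_neg h

theorem feasible_of_eq_none {i : Fin 2} {t : ℕ} {r : List StageRecord} (h : holding r i = none) :
    feasible i t r = Finset.insertNone (available t r) :=
  if_pos h

theorem available_of_forall_eq_none {t : ℕ} {r : List StageRecord} (h : ∀ i, holding r i = none) :
    available t r = Finset.range (t + 2) := by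
  simp [available, h]

theorem feasible_of_forall_eq_none {t : ℕ} {r : List StageRecord} (h : ∀ i, holding r i = none)
    (i : Fin 2) : feasible i t r = Finset.insertNone (Finset.range (t + 2)) := by
  rw [feasible_of_eq_none (h i), available_of_forall_eq_none h]

theorem available_cons_of_got_none {t : ℕ} {ρ : StageRecord} {r : List StageRecord}
    (hb : ∀ i l, holding r i = some l → l < t + 2) (hρ : ∀ i, ρ.got i = none) :
    available (t + 1) (ρ :: r) = insert (t + 2) (available t r) := by
  ext j
  simp only [available, holding_cons, hρ, Option.none_or, Finset.mem_filter, Finset.mem_insert,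
    Finset.mem_range]
  constructor
  · rintro ⟨h1, h2⟩
    rcases Nat.lt_or_ge j (t + 2) with h | h
    · exact Or.inr ⟨h, h2⟩
    · exact Or.inl (by omega)
  · rintro (rfl | ⟨h1, h2⟩)
    · exact ⟨by omega, fun i hi => lt_irrefl _ (hb i _ hi)⟩
    · exact ⟨by omega, h2⟩

theorem available_cons_of_taken {i j : Fin 2} (hij : i ≠ j) {t l : ℕ} (hl : l < t + 2)
    {r : List StageRecord} (h : ∀ i, holding r i = none) (bid : Fin 2 → Option ℕ) :
    available (t + 1) (⟨bid, joint i none (some l)⟩ :: r) =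
      insert (t + 2) ((Finset.range (t + 2)).erase l) := by
  ext m
  simp only [available, holding_cons, h, Option.or_none, Finset.mem_filter, Finset.mem_insert,
    Finset.mem_range, Finset.mem_erase, forall_fin_two_iff hij, joint_self, joint_of_ne hij]
  simp only [ne_eq, reduceCtorEq, not_false_eq_true, true_and, Option.some.injEq]
  omega

theorem lt_of_mem_feasible {i : Fin 2} {t l : ℕ} {r : List StageRecord}
    (h : some l ∈ feasible i t r) : l < t + 2 := by
  unfold feasible at h
  split_ifs at h
  · exact Finset.mem_range.1 (available_subset t r (Finset.some_mem_insertNone.1 h))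
  · simp at h

theorem got_eq_of_mem_allocations {bid g : Fin 2 → Option ℕ} (hg : g ∈ allocations bid)
    (i : Fin 2) : g i = none ∨ g i = bid i := by
  unfold allocations at hg
  split_ifs at hg
  · rcases Finset.mem_insert.1 hg with rfl | hg
    · fin_cases i <;> simp
    · rw [Finset.mem_singleton.1 hg]
      fin_cases i <;> simp
  · rw [Finset.mem_singleton.1 hg]
    exact Or.inr rfl

theorem IsPast.lt_of_holding {r : List StageRecord} (h : IsPast r) {i : Fin 2} {l : ℕ}
    (hl : holding r i = some l) : l < r.length + 2 := by
  induction r with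
  | nil => simp [holding] at hl
  | cons ρ r ih =>
    obtain ⟨h1, h2, h3⟩ := h
    rw [holding_cons] at hl
    rw [List.length_cons]
    rcases got_eq_of_mem_allocations h3 i with hg | hg
    · rw [hg, Option.none_or] at hl
      have := ih h1 hl
      omega
    · rcases hbid : ρ.bid i with _ | l'
      · rw [hg, hbid, Option.none_or] at hl
        have := ih h1 hl
        omega
      · rw [hg, hbid, Option.some_or, Option.some.injEq] at hl
        have := lt_of_mem_feasible (hbid ▸ h2 i)
        omega

theorem IsHistory.lt_of_holding {a b : ℝ} {t : ℕ} {x : Fin (t + 2) → ℝ} {r : List StageRecord}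
    (h : IsHistory a b t x r) (i : Fin 2) (l : ℕ) (hl : holding r i = some l) : l < t + 2 :=
  h.length_eq ▸ h.isPast.lt_of_holding hl

theorem IsHistory.cons {a b : ℝ} {t : ℕ} {x : Fin (t + 2) → ℝ} {r : List StageRecord}
    (h : IsHistory a b t x r) {y : ℝ} (hy : y ∈ Set.Icc (0 : ℝ) 1) {bid got : Fin 2 → Option ℕ}
    (hbid : ∀ i, bid i ∈ feasible i t r) (hgot : got ∈ allocations bid) :
    IsHistory a b (t + 1) (addSample x y) (⟨bid, got⟩ :: r) where
  fst_eq := (Fin.snoc_castSucc (α := fun _ => ℝ) y x 0).trans h.fst_eq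
  snd_eq := (Fin.snoc_castSucc (α := fun _ => ℝ) y x 1).trans h.snd_eq
  mem_Icc := addSample_mem_Icc h.mem_Icc hy
  length_eq := by rw [List.length_cons, h.length_eq]
  isPast := ⟨h.isPast, h.length_eq.symm ▸ hbid, hgot⟩

end Bids

/-! ### Expected payoffs, and the subgames where one player has left. -/

section Payoffs

variable {μ : Measure ℝ} {σ : (i : Fin 2) → Strategy i} {k t : ℕ} {x : Fin (t + 2) → ℝ}
  {r : List StageRecord} {i j : Fin 2}

/-- The expected payoff of player `i` after the bids `bid` and the allocation `got`. -/
noncomputable def allocPayoff (μ : Measure ℝ) (σ : (i : Fin 2) → Strategy i) (k t : ℕ)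
    (x : Fin (t + 2) → ℝ) (r : List StageRecord) (i : Fin 2) (bid got : Fin 2 → Option ℕ) : ℝ :=
  ∫ y, expectedPayoff μ σ k (t + 1) (addSample x y) (⟨bid, got⟩ :: r) i ∂μ

/-- The expected payoff of player `i` after the bids `bid`. -/
noncomputable def bidPayoff (μ : Measure ℝ) (σ : (i : Fin 2) → Strategy i) (k t : ℕ)
    (x : Fin (t + 2) → ℝ) (r : List StageRecord) (i : Fin 2) (bid : Fin 2 → Option ℕ) : ℝ :=
  (∑ g ∈ allocations bid, allocPayoff μ σ k t x r i bid g) / ((allocations bid).card : ℝ)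

theorem bidPayoff_of_not (l : Fin 2) {α β : Option ℕ} (h : ¬(α = β ∧ α ≠ none)) :
    bidPayoff μ σ k t x r i (joint l α β) =
      allocPayoff μ σ k t x r i (joint l α β) (joint l α β) := by
  simp [bidPayoff, allocations_joint_of_not l h]

theorem bidPayoff_same (i : Fin 2) (l : ℕ) :
    bidPayoff μ σ k t x r i (joint i (some l) (some l)) =
      (allocPayoff μ σ k t x r i (joint i (some l) (some l)) (joint i (some l) none) +
        allocPayoff μ σ k t x r i (joint i (some l) (some l)) (joint i none (some l))) / 2 := by
  have hne : joint i (some l) none ≠ joint i none (some l) := fun h => by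
    have := congrFun h i
    simp at this
  rw [bidPayoff, allocations_joint_same, Finset.sum_pair hne, Finset.card_pair hne]
  norm_num

/-- The defining double sum is always ordered by player `0` first. Here it is rearranged as own
mixture over opponent's mixture, the form in which best responses are read off. -/
theorem expectedPayoff_succ (hij : i ≠ j) :
    expectedPayoff μ σ (k + 1) t x r i =
      ∑ α ∈ feasible i t r, (σ i).act t x r α *
        ∑ β ∈ feasible j t r, (σ j).act t x r β * bidPayoff μ σ k t x r i (joint i α β) := by
  have h : expectedPayoff μ σ (k + 1) t x r i = ∑ α ∈ feasible 0 t r, ∑ β ∈ feasible 1 t r,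
      (σ 0).act t x r α * (σ 1).act t x r β * bidPayoff μ σ k t x r i (joint 0 α β) := by
    rw [expectedPayoff]
    simp only [← cons_eq_joint_zero]
    rfl
  rw [h]
  simp only [Finset.mul_sum, ← mul_assoc]
  obtain ⟨rfl, rfl⟩ | ⟨rfl, rfl⟩ : (i = 0 ∧ j = 1) ∨ (i = 1 ∧ j = 0) := by
    fin_cases i <;> fin_cases j <;> simp at hij ⊢
  · rfl
  · rw [Finset.sum_comm]
    refine Finset.sum_congr rfl fun α _ => Finset.sum_congr rfl fun β _ => ?_
    rw [joint_swap (i := 0) (j := 1) (by decide), mul_comm ((σ 0).act t x r β)]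

theorem measurable_finalPayoff (t : ℕ) (r : List StageRecord) (i : Fin 2) :
    Measurable fun x : Fin (t + 2) → ℝ => finalPayoff t x r i := by
  unfold finalPayoff
  have h1 := measurable_bestValue (measurable_itemValue (t := t)) (available t r)
  have h2 := measurable_secondValue (measurable_itemValue (t := t)) (available t r)
  rcases holding r i with _ | l
  · simp only
    split_ifs
    · exact (h1.add h2).div_const 2
    · exact h1
  · exact measurable_itemValue l

theorem finalPayoff_mem_Icc (hx : ∀ j, x j ∈ Set.Icc (0 : ℝ) 1) (r : List StageRecord)
    (i : Fin 2) : finalPayoff t x r i ∈ Set.Icc (0 : ℝ) 1 := by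
  unfold finalPayoff
  have h1 := bestValue_mem_Icc (itemValue_mem_Icc hx) (available t r)
  have h2 := secondValue_mem_Icc (itemValue_mem_Icc hx) (available t r)
  rcases holding r i with _ | l
  · simp only
    split_ifs
    · exact ⟨by linarith [h1.1, h2.1], by linarith [h1.2, h2.2]⟩
    · exact h1
  · exact itemValue_mem_Icc hx l

theorem measurable_expectedPayoff [SFinite μ] (σ : (i : Fin 2) → Strategy i) (k t : ℕ)
    (r : List StageRecord) (i : Fin 2) :
    Measurable fun x : Fin (t + 2) → ℝ => expectedPayoff μ σ k t x r i := by
  induction k generalizing t r with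
  | zero => exact measurable_finalPayoff t r i
  | succ k ih =>
    simp only [expectedPayoff]
    refine Finset.measurable_sum _ fun α _ => Finset.measurable_sum _ fun β _ =>
      (((σ 0).measurable_act t r α).mul ((σ 1).measurable_act t r β)).mul
        ((Finset.measurable_sum _ fun g _ => ?_).div_const _)
    exact measurable_integral_right (f := fun (x : Fin (t + 2) → ℝ) y =>
      expectedPayoff μ σ k (t + 1) (addSample x y) (⟨![α, β], g⟩ :: r) i)
      ((ih (t + 1) _).comp measurable_addSample)

theorem measurable_expectedPayoff_addSample [SFinite μ] (σ : (i : Fin 2) → Strategy i) (k t : ℕ)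
    (x : Fin (t + 2) → ℝ) (r : List StageRecord) (i : Fin 2) :
    Measurable fun y => expectedPayoff μ σ k (t + 1) (addSample x y) r i :=
  (measurable_expectedPayoff σ k (t + 1) r i).comp
    (measurable_addSample.comp (measurable_const (a := x).prodMk measurable_id))

theorem Strategy.sum_act_mul_eq (s : Strategy i) {α : Option ℕ} (h : s.act t x r α = 1)
    (f : Option ℕ → ℝ) : ∑ β ∈ feasible i t r, s.act t x r β * f β = f α := by
  have hα : α ∈ feasible i t r := by
    by_contra hc
    rw [s.act_eq_zero _ _ _ _ hc] at h
    exact zero_ne_one h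
  have h0 : ∑ β ∈ (feasible i t r).erase α, s.act t x r β = 0 := by
    have := s.sum_act t x r
    rw [← Finset.add_sum_erase _ _ hα, h] at this
    linarith
  rw [Finset.sum_eq_single_of_mem α hα fun β hβ hne => ?_, h, one_mul]
  rw [(Finset.sum_eq_zero_iff_of_nonneg fun β _ => s.act_nonneg t x r β).1 h0 β
    (Finset.mem_erase.2 ⟨hne, hβ⟩), zero_mul]

theorem Strategy.sum_act_mul_le (s : Strategy i) {f : Option ℕ → ℝ} {u : ℝ}
    (h : ∀ α ∈ feasible i t r, f α ≤ u) : ∑ α ∈ feasible i t r, s.act t x r α * f α ≤ u := by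
  calc _ ≤ ∑ α ∈ feasible i t r, s.act t x r α * u :=
        Finset.sum_le_sum fun α hα => mul_le_mul_of_nonneg_left (h α hα) (s.act_nonneg t x r α)
    _ = u := by rw [← Finset.sum_mul, s.sum_act, one_mul]

theorem Strategy.sum_act_mul_congr (s : Strategy i) {f : Option ℕ → ℝ} {u : ℝ}
    (h : ∀ α ∈ feasible i t r, f α = u) : ∑ α ∈ feasible i t r, s.act t x r α * f α = u := by
  rw [Finset.sum_congr rfl fun α hα => by rw [h α hα], ← Finset.sum_mul, s.sum_act, one_mul]

variable [IsProbabilityMeasure μ]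

theorem expectedPayoff_mem_Icc (hμ : μ (Set.Icc (0 : ℝ) 1)ᶜ = 0) (σ : (i : Fin 2) → Strategy i)
    (k : ℕ) (hx : ∀ j, x j ∈ Set.Icc (0 : ℝ) 1) (r : List StageRecord) (i : Fin 2) :
    expectedPayoff μ σ k t x r i ∈ Set.Icc (0 : ℝ) 1 := by
  induction k generalizing t r with
  | zero => exact finalPayoff_mem_Icc hx r i
  | succ k ih =>
    have hcomb : ∀ {i : Fin 2} (s : Strategy i) {f : Option ℕ → ℝ},
        (∀ α ∈ feasible i t r, f α ∈ Set.Icc (0 : ℝ) 1) →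
        ∑ α ∈ feasible i t r, s.act t x r α * f α ∈ Set.Icc (0 : ℝ) 1 := fun s f hf =>
      ⟨Finset.sum_nonneg fun α hα => mul_nonneg (s.act_nonneg t x r α) (hf α hα).1,
        s.sum_act_mul_le fun α hα => (hf α hα).2⟩
    have hcont : ∀ bid got, allocPayoff μ σ k t x r i bid got ∈ Set.Icc (0 : ℝ) 1 :=
      fun bid got => integral_mem_Icc hμ (measurable_expectedPayoff_addSample σ k t x _ i)
        fun y hy => ih (addSample_mem_Icc hx hy) _
    obtain ⟨j, hij⟩ : ∃ j, i ≠ j := (exists_ne i).imp fun _ h => h.symm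
    rw [expectedPayoff_succ hij]
    refine hcomb _ fun α _ => hcomb _ fun β _ => ?_
    by_cases h : α = β ∧ α ≠ none
    · obtain ⟨rfl, h⟩ := h
      obtain ⟨l, rfl⟩ := Option.ne_none_iff_exists'.1 h
      rw [bidPayoff_same]
      exact ⟨by linarith [(hcont (joint i (some l) (some l)) (joint i (some l) none)).1,
        (hcont (joint i (some l) (some l)) (joint i none (some l))).1],
        by linarith [(hcont (joint i (some l) (some l)) (joint i (some l) none)).2,
          (hcont (joint i (some l) (some l)) (joint i none (some l))).2]⟩
    · rw [bidPayoff_of_not i h]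
      exact hcont _ _

theorem integrable_expectedPayoff (hμ : μ (Set.Icc (0 : ℝ) 1)ᶜ = 0)
    (σ : (i : Fin 2) → Strategy i) (k : ℕ) (hx : ∀ j, x j ∈ Set.Icc (0 : ℝ) 1)
    (r : List StageRecord) (i : Fin 2) :
    Integrable (fun y => expectedPayoff μ σ k (t + 1) (addSample x y) r i) μ :=
  integrable_of_mem_Icc hμ (measurable_expectedPayoff_addSample σ k t x r i)
    fun _ hy => expectedPayoff_mem_Icc hμ σ k (addSample_mem_Icc hx hy) r i

theorem expectedPayoff_of_holding (σ : (i : Fin 2) → Strategy i) (k : ℕ) {l : ℕ}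
    (hl : holding r i = some l) (hlt : l < t + 2) :
    expectedPayoff μ σ k t x r i = itemValue x l := by
  induction k generalizing t r with
  | zero => simp [expectedPayoff, finalPayoff, hl]
  | succ k ih =>
    obtain ⟨j, hij⟩ : ∃ j, i ≠ j := (exists_ne i).imp fun _ h => h.symm
    rw [expectedPayoff_succ hij]
    refine (σ i).sum_act_mul_congr fun α hα => (σ j).sum_act_mul_congr fun β _ => ?_
    rw [feasible_of_ne_none (by simp [hl]), Finset.mem_singleton] at hα
    subst hα
    rw [bidPayoff_of_not i (by simp), allocPayoff]
    have : ∀ y, expectedPayoff μ σ k (t + 1) (addSample x y)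
        (⟨joint i none β, joint i none β⟩ :: r) i = itemValue x l := fun y => by
      rw [ih (by simpa [holding_cons] using hl) (by omega), itemValue_addSample_of_lt _ _ hlt]
    simp [this]

theorem allocPayoff_of_got {l : ℕ} (hlt : l < t + 2) (bid : Fin 2 → Option ℕ)
    {got : Fin 2 → Option ℕ} (hg : got i = some l) :
    allocPayoff μ σ k t x r i bid got = itemValue x l := by
  have : ∀ y, expectedPayoff μ σ k (t + 1) (addSample x y) (⟨bid, got⟩ :: r) i = itemValue x l :=
    fun y => by
      rw [expectedPayoff_of_holding σ k (l := l) (by simp [holding_cons, hg]) (by omega),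
        itemValue_addSample_of_lt _ _ hlt]
  simp [allocPayoff, this]

theorem bidPayoff_some_of_ne {l : ℕ} (hlt : l < t + 2) {β : Option ℕ} (hβ : β ≠ some l) :
    bidPayoff μ σ k t x r i (joint i (some l) β) = itemValue x l := by
  rw [bidPayoff_of_not i fun h => hβ h.1.symm]
  exact allocPayoff_of_got hlt _ (joint_self _ _ _)

theorem bidPayoff_same_eq {l : ℕ} (hlt : l < t + 2) :
    bidPayoff μ σ k t x r i (joint i (some l) (some l)) = (itemValue x l +
      allocPayoff μ σ k t x r i (joint i (some l) (some l)) (joint i none (some l))) / 2 := by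
  rw [bidPayoff_same, allocPayoff_of_got hlt _ (joint_self _ _ _)]

theorem integral_waitValue_bestValue (hμ : μ (Set.Icc (0 : ℝ) 1)ᶜ = 0)
    (hx : ∀ j, x j ∈ Set.Icc (0 : ℝ) 1) {S : Finset ℕ} (hS : S ⊆ Finset.range (t + 2)) (k : ℕ) :
    ∫ y, waitValue μ k (bestValue (itemValue (addSample x y)) (insert (t + 2) S)) ∂μ =
      waitValue μ (k + 1) (bestValue (itemValue x) S) :=
  integral_congr_of_Icc hμ fun y hy => by rw [bestValue_addSample hx hy hS]

theorem integrable_waitValue_bestValue (hμ : μ (Set.Icc (0 : ℝ) 1)ᶜ = 0)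
    (hx : ∀ j, x j ∈ Set.Icc (0 : ℝ) 1) (S : Finset ℕ) (k : ℕ) :
    Integrable (fun y => waitValue μ k (bestValue (itemValue (addSample x y)) S)) μ := by
  refine integrable_of_mem_Icc hμ ((measurable_waitValue k).comp
    (measurable_bestValue (fun j => ?_) S)) fun y hy => waitValue_mem_Icc hμ k
      (bestValue_mem_Icc (itemValue_mem_Icc (addSample_mem_Icc hx hy)) S)
  exact (measurable_itemValue j).comp
    (measurable_addSample.comp (measurable_const (a := x).prodMk measurable_id))

/-- A lone player who passes keeps all items and gains a sample, while one who takes an item gets at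
most the current best, which is below its waiting value. The bound holds for every strategy. -/
theorem expectedPayoff_alone_le (hμ : μ (Set.Icc (0 : ℝ) 1)ᶜ = 0) (σ : (i : Fin 2) → Strategy i)
    (k : ℕ) (hx : ∀ j, x j ∈ Set.Icc (0 : ℝ) 1) (hij : i ≠ j)
    (hb : ∀ i l, holding r i = some l → l < t + 2) (hi : holding r i = none)
    (hj : holding r j ≠ none) :
    expectedPayoff μ σ k t x r i ≤ waitValue μ k (bestValue (itemValue x) (available t r)) := by
  induction k generalizing t r with
  | zero =>
    have : ¬∀ i', holding r i' = none := fun h => hj (h j)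
    simp [expectedPayoff, finalPayoff, hi, this, waitValue]
  | succ k ih =>
    rw [expectedPayoff_succ hij]
    refine (σ i).sum_act_mul_le fun α hα => (σ j).sum_act_mul_le fun β hβ => ?_
    rw [feasible_of_ne_none hj, Finset.mem_singleton] at hβ
    subst hβ
    rcases α with _ | l
    · rw [bidPayoff_of_not i (by simp), allocPayoff,
        ← integral_waitValue_bestValue hμ hx (available_subset t r)]
      have hn : ∀ i', joint i none none i' = none := fun i' => by simp [joint]
      have hav := available_cons_of_got_none hb (ρ := ⟨joint i none none, joint i none none⟩) hn
      refine integral_mono_of_Icc hμ (integrable_expectedPayoff hμ σ k hx _ i)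
        (integrable_waitValue_bestValue hμ hx _ k) fun y hy => ?_
      rw [← hav]
      refine ih (addSample_mem_Icc hx hy) (fun i' l hl => ?_) ?_ ?_
      · rw [holding_cons_none] at hl
        have := hb i' l hl
        omega
      · rwa [holding_cons_none]
      · rwa [holding_cons_none]
    · rw [feasible_of_eq_none hi, Finset.some_mem_insertNone] at hα
      rw [bidPayoff_some_of_ne (Finset.mem_range.1 (available_subset t r hα)) (by simp)]
      exact (le_bestValue hα).trans
        (le_waitValue hμ _ (bestValue_mem_Icc (itemValue_mem_Icc hx) _))

/-- Passing whenever alone attains the bound. This serves both as a deviation in an arbitrary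
equilibrium and to evaluate the explicit profiles. -/
theorem expectedPayoff_alone_eq (hμ : μ (Set.Icc (0 : ℝ) 1)ᶜ = 0) {σ : (i : Fin 2) → Strategy i}
    (hij : i ≠ j)
    (hσ : ∀ t x r, holding r i = none → holding r j ≠ none → (σ i).act t x r none = 1)
    (k : ℕ) (hx : ∀ j, x j ∈ Set.Icc (0 : ℝ) 1)
    (hb : ∀ i l, holding r i = some l → l < t + 2) (hi : holding r i = none)
    (hj : holding r j ≠ none) :
    expectedPayoff μ σ k t x r i = waitValue μ k (bestValue (itemValue x) (available t r)) := by
  induction k generalizing t r with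
  | zero =>
    have : ¬∀ i', holding r i' = none := fun h => hj (h j)
    simp [expectedPayoff, finalPayoff, hi, this, waitValue]
  | succ k ih =>
    rw [expectedPayoff_succ hij, (σ i).sum_act_mul_eq (hσ t x r hi hj)]
    refine (σ j).sum_act_mul_congr fun β hβ => ?_
    rw [feasible_of_ne_none hj, Finset.mem_singleton] at hβ
    subst hβ
    rw [bidPayoff_of_not i (by simp), allocPayoff,
      ← integral_waitValue_bestValue hμ hx (available_subset t r)]
    have hn : ∀ i', joint i none none i' = none := fun i' => by simp [joint]
    have hav := available_cons_of_got_none hb (ρ := ⟨joint i none none, joint i none none⟩) hn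
    refine integral_congr_of_Icc hμ fun y hy => ?_
    rw [← hav]
    refine ih (addSample_mem_Icc hx hy) (fun i' l hl => ?_) ?_ ?_
    · rw [holding_cons_none] at hl
      have := hb i' l hl
      omega
    · rwa [holding_cons_none]
    · rwa [holding_cons_none]

theorem holding_cons_taken (hij : i ≠ j) (h : ∀ i, holding r i = none) {l : ℕ} (hl : l < t + 2)
    (bid : Fin 2 → Option ℕ) :
    (∀ i' l', holding (⟨bid, joint i none (some l)⟩ :: r) i' = some l' → l' < t + 1 + 2) ∧
      holding (⟨bid, joint i none (some l)⟩ :: r) i = none ∧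
      holding (⟨bid, joint i none (some l)⟩ :: r) j ≠ none := by
  simp only [holding_cons, h, Option.or_none, joint_self, joint_of_ne hij]
  refine ⟨(forall_fin_two_iff hij).2 ⟨by simp, fun l' hl' => ?_⟩, trivial, by simp⟩
  rw [joint_of_ne hij, Option.some.injEq] at hl'
  omega

theorem allocPayoff_taken_le (hμ : μ (Set.Icc (0 : ℝ) 1)ᶜ = 0) (σ : (i : Fin 2) → Strategy i)
    (k : ℕ) (hx : ∀ j, x j ∈ Set.Icc (0 : ℝ) 1) (h : ∀ i, holding r i = none) {l : ℕ}
    (hl : l < t + 2) (bid : Fin 2 → Option ℕ) :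
    allocPayoff μ σ k t x r i bid (joint i none (some l)) ≤
      waitValue μ (k + 1) (bestValue (itemValue x) ((Finset.range (t + 2)).erase l)) := by
  obtain ⟨j, hij⟩ : ∃ j, i ≠ j := (exists_ne i).imp fun _ h => h.symm
  obtain ⟨h1, h2, h3⟩ := holding_cons_taken hij h hl bid
  rw [← integral_waitValue_bestValue hμ hx (Finset.erase_subset _ _)]
  refine integral_mono_of_Icc hμ (integrable_expectedPayoff hμ σ k hx _ i)
    (integrable_waitValue_bestValue hμ hx _ k) fun y hy => ?_
  rw [← available_cons_of_taken hij hl h bid]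
  exact expectedPayoff_alone_le hμ σ k (addSample_mem_Icc hx hy) hij h1 h2 h3

/-- Optimal play of the remaining player is left as the hypothesis `hopt`, because it comes from
subgame perfection in one use and from an explicit strategy in the other. -/
theorem allocPayoff_taken_eq (hμ : μ (Set.Icc (0 : ℝ) 1)ᶜ = 0)
    (hx : ∀ j, x j ∈ Set.Icc (0 : ℝ) 1) (h : ∀ i, holding r i = none) {l : ℕ}
    (hl : l < t + 2) {bid : Fin 2 → Option ℕ}
    (hopt : ∀ y ∈ Set.Icc (0 : ℝ) 1,
      expectedPayoff μ σ k (t + 1) (addSample x y) (⟨bid, joint i none (some l)⟩ :: r) i =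
        waitValue μ k (bestValue (itemValue (addSample x y))
          (available (t + 1) (⟨bid, joint i none (some l)⟩ :: r)))) :
    allocPayoff μ σ k t x r i bid (joint i none (some l)) =
      waitValue μ (k + 1) (bestValue (itemValue x) ((Finset.range (t + 2)).erase l)) := by
  obtain ⟨j, hij⟩ : ∃ j, i ≠ j := (exists_ne i).imp fun _ h => h.symm
  rw [← integral_waitValue_bestValue hμ hx (Finset.erase_subset _ _)]
  refine integral_congr_of_Icc hμ fun y hy => ?_
  rw [← available_cons_of_taken hij hl h bid]
  exact hopt y hy

end Payoffs

/-! ### Nash equilibria of the one-stage game. -/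

section StageGame

/-- The payoff of a player who chooses the first action against the second one in a stage of the
game: `v j` is the value of item `j`, `y j` what a player gets after his opponent left with item
`j`, and `z` what both get if nobody bids. -/
noncomputable def stageGame (v y : ℕ → ℝ) (z : ℝ) : Option ℕ → Option ℕ → ℝ
  | none, none => z
  | none, some j => y j
  | some j, β => if β = some j then (v j + y j) / 2 else v j

theorem sum_mul_lt_sum_mul {ι : Type*} {T : Finset ι} {q φ ψ : ι → ℝ} (hq : ∀ i ∈ T, 0 ≤ q i)
    (hq1 : ∑ i ∈ T, q i = 1) (h : ∀ i ∈ T, φ i < ψ i) :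
    ∑ i ∈ T, q i * φ i < ∑ i ∈ T, q i * ψ i := by
  refine Finset.sum_lt_sum (fun i hi => mul_le_mul_of_nonneg_left (h i hi).le (hq i hi)) ?_
  obtain ⟨i, hi, hpos⟩ : ∃ i ∈ T, 0 < q i := by
    by_contra! hc
    linarith [Finset.sum_nonpos hc]
  exact ⟨i, hi, mul_lt_mul_of_pos_left (h i hi) hpos⟩

/-- A mixture whose mean equals an upper bound of all the values puts no weight on values strictly
below that bound. -/
theorem weight_eq_zero_of_lt {ι : Type*} {T : Finset ι} {p f : ι → ℝ} {u : ℝ}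
    (hp : ∀ i ∈ T, 0 ≤ p i) (hp1 : ∑ i ∈ T, p i = 1) (hu : u = ∑ i ∈ T, p i * f i)
    (hf : ∀ i ∈ T, f i ≤ u) {i : ι} (hi : i ∈ T) (hlt : f i < u) : p i = 0 := by
  have h0 : ∑ i ∈ T, p i * (u - f i) = 0 := by
    simp only [mul_sub, Finset.sum_sub_distrib, ← Finset.sum_mul, hp1, one_mul, ← hu, sub_self]
  have := (Finset.sum_eq_zero_iff_of_nonneg fun j hj =>
    mul_nonneg (hp j hj) (sub_nonneg.2 (hf j hj))).1 h0 i hi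
  rcases mul_eq_zero.1 this with h | h
  · exact h
  · linarith

variable {S : Finset ℕ} {m : ℕ} {v y : ℕ → ℝ} {z : ℝ} {p q : Option ℕ → ℝ} {u u' : ℝ}

/-- An item other than the best one may be undominated by any single action, but it is strictly
dominated by the even mixture of passing and bidding for the best item. -/
theorem weight_other_eq_zero (hm : m ∈ S) (hmy : y m < v m)
    (hv : ∀ j ∈ S, j ≠ m → v j ≤ y m) (hy : ∀ j ∈ S, j ≠ m → v m ≤ y j)
    (hz : (v m + y m) / 2 ≤ z)
    (hp : ∀ α ∈ Finset.insertNone S, 0 ≤ p α) (hp1 : ∑ α ∈ Finset.insertNone S, p α = 1)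
    (hq : ∀ α ∈ Finset.insertNone S, 0 ≤ q α) (hq1 : ∑ α ∈ Finset.insertNone S, q α = 1)
    (hu : u = ∑ α ∈ Finset.insertNone S, p α *
      ∑ β ∈ Finset.insertNone S, q β * stageGame v y z α β)
    (hN : ∀ α ∈ Finset.insertNone S, ∑ β ∈ Finset.insertNone S, q β * stageGame v y z α β ≤ u)
    {j : ℕ} (hj : j ∈ S) (hjm : j ≠ m) : p (some j) = 0 := by
  refine weight_eq_zero_of_lt hp hp1 hu hN (Finset.some_mem_insertNone.2 hj) ?_
  -- The mixture is compared against each opposing action separately: pass, the best item `m`, the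
  -- same item `j`, and any third item.
  have key : ∑ β ∈ Finset.insertNone S, q β * stageGame v y z (some j) β <
      ∑ β ∈ Finset.insertNone S,
        q β * ((stageGame v y z none β + stageGame v y z (some m) β) / 2) := by
    refine sum_mul_lt_sum_mul hq hq1 fun β hβ => ?_
    have h1 := hv j hj hjm
    have h2 := hy j hj hjm
    rcases β with _ | l
    · simp [stageGame]; linarith
    · rw [Finset.some_mem_insertNone] at hβ
      by_cases hlm : l = m
      · subst hlm
        simp [stageGame, hjm.symm]; linarith
      · have h3 := hy l hβ hlm
        by_cases hlj : l = j
        · subst hlj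
          simp [stageGame, hlm]; linarith
        · simp [stageGame, hlm, hlj]; linarith
  have e : ∑ β ∈ Finset.insertNone S,
        q β * ((stageGame v y z none β + stageGame v y z (some m) β) / 2) =
      ((∑ β ∈ Finset.insertNone S, q β * stageGame v y z none β) +
        ∑ β ∈ Finset.insertNone S, q β * stageGame v y z (some m) β) / 2 := by
    rw [← Finset.sum_add_distrib, Finset.sum_div]
    exact Finset.sum_congr rfl fun _ _ => by ring
  have h1 := hN none (Finset.none_mem_insertNone)
  have h2 := hN (some m) (Finset.some_mem_insertNone.2 hm)
  linarith

theorem weight_bid_eq_zero (hvm : ∀ j ∈ S, v j ≤ v m) (hmy : v m < y m)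
    (hy : ∀ j ∈ S, y m ≤ y j) (hz : (v m + y m) / 2 ≤ z)
    (hp : ∀ α ∈ Finset.insertNone S, 0 ≤ p α) (hp1 : ∑ α ∈ Finset.insertNone S, p α = 1)
    (hq : ∀ α ∈ Finset.insertNone S, 0 ≤ q α) (hq1 : ∑ α ∈ Finset.insertNone S, q α = 1)
    (hu : u = ∑ α ∈ Finset.insertNone S, p α *
      ∑ β ∈ Finset.insertNone S, q β * stageGame v y z α β)
    (hN : ∀ α ∈ Finset.insertNone S, ∑ β ∈ Finset.insertNone S, q β * stageGame v y z α β ≤ u)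
    {j : ℕ} (hj : j ∈ S) : p (some j) = 0 := by
  refine weight_eq_zero_of_lt hp hp1 hu hN (Finset.some_mem_insertNone.2 hj)
    (lt_of_lt_of_le ?_ (hN none Finset.none_mem_insertNone))
  refine sum_mul_lt_sum_mul hq hq1 fun β hβ => ?_
  have h1 := hvm j hj
  rcases β with _ | l
  · simp [stageGame]; linarith
  · rw [Finset.some_mem_insertNone] at hβ
    have h2 := hy l hβ
    by_cases hlj : l = j
    · subst hlj
      simp [stageGame]; linarith
    · simp [stageGame, hlj]; linarith

theorem sum_insertNone_of_forall_eq_zero {r : Option ℕ → ℝ} (hm : m ∈ S)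
    (h : ∀ j ∈ S, j ≠ m → r (some j) = 0) (f : Option ℕ → ℝ) :
    ∑ α ∈ Finset.insertNone S, r α * f α = r none * f none + r (some m) * f (some m) := by
  rw [Finset.sum_insertNone]
  congr 1
  exact Finset.sum_eq_single_of_mem m hm fun j hj hjm => by rw [h j hj hjm, zero_mul]

/-- When `v m = y m`, every bid is worth at most `v m`. Opposing bids with `y j > v m` have weight
zero, so passing yields exactly `v m` plus a bonus when the opponent also passes. Bids for other
items need not vanish under ties, so only payoffs are bounded. -/
theorem le_and_le_of_balanced (hmy : v m = y m) (hyj : ∀ j ∈ S, v m ≤ y j)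
    (hvm : ∀ j ∈ S, v j ≤ v m) (hsum : ∀ j ∈ S, y j + v j ≤ y m + v m)
    (hp : ∀ α ∈ Finset.insertNone S, 0 ≤ p α) (hp1 : ∑ α ∈ Finset.insertNone S, p α = 1)
    (hq : ∀ α ∈ Finset.insertNone S, 0 ≤ q α) (hq1 : ∑ α ∈ Finset.insertNone S, q α = 1)
    (hu : u = ∑ α ∈ Finset.insertNone S, p α *
      ∑ β ∈ Finset.insertNone S, q β * stageGame v y z α β)
    (hN : ∀ α ∈ Finset.insertNone S, ∑ β ∈ Finset.insertNone S, q β * stageGame v y z α β ≤ u)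
    (hq0 : ∀ j ∈ S, v m < y j → q (some j) = 0) :
    v m + q none * (z - v m) ≤ u ∧ u ≤ v m + p none * (q none * (z - v m)) := by
  rw [Finset.sum_insertNone] at hp1 hq1
  have hq0' : ∀ j ∈ S, q (some j) * y j = q (some j) * v m := by
    intro j hj
    rcases (hyj j hj).lt_or_eq with h | h
    · rw [hq0 j hj h]; simp
    · rw [h]
  have hnone : ∑ β ∈ Finset.insertNone S, q β * stageGame v y z none β =
      v m + q none * (z - v m) := by
    rw [Finset.sum_insertNone]
    simp only [stageGame]
    rw [Finset.sum_congr rfl hq0', ← Finset.sum_mul]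
    linear_combination v m * hq1
  have hsome : ∀ j ∈ S, ∑ β ∈ Finset.insertNone S, q β * stageGame v y z (some j) β ≤ v m := by
    intro j hj
    calc _ ≤ ∑ β ∈ Finset.insertNone S, q β * v m := by
          refine Finset.sum_le_sum fun β hβ => mul_le_mul_of_nonneg_left ?_ (hq β hβ)
          simp only [stageGame]
          split_ifs
          · linarith [hsum j hj]
          · exact hvm j hj
      _ = v m := by rw [← Finset.sum_mul, Finset.sum_insertNone, hq1, one_mul]
  refine ⟨hnone ▸ hN none Finset.none_mem_insertNone, ?_⟩
  rw [hu, Finset.sum_insertNone, hnone]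
  have := Finset.sum_le_sum fun j hj => mul_le_mul_of_nonneg_left (hsome j hj)
    (hp (some j) (Finset.some_mem_insertNone.2 hj))
  rw [← Finset.sum_mul] at this
  linear_combination this + v m * hp1

theorem weight_eq_zero_of_balanced (hmy : v m = y m) (hyj : ∀ j ∈ S, v m ≤ y j)
    (hsum : ∀ j ∈ S, y j + v j ≤ y m + v m) (hz : v m ≤ z)
    (hp : ∀ α ∈ Finset.insertNone S, 0 ≤ p α) (hp1 : ∑ α ∈ Finset.insertNone S, p α = 1)
    (hq : ∀ α ∈ Finset.insertNone S, 0 ≤ q α) (hq1 : ∑ α ∈ Finset.insertNone S, q α = 1)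
    (hu : u = ∑ α ∈ Finset.insertNone S, p α *
      ∑ β ∈ Finset.insertNone S, q β * stageGame v y z α β)
    (hN : ∀ α ∈ Finset.insertNone S, ∑ β ∈ Finset.insertNone S, q β * stageGame v y z α β ≤ u)
    {j : ℕ} (hj : j ∈ S) (h : v m < y j) : p (some j) = 0 := by
  have h1 := hsum j hj
  refine weight_eq_zero_of_lt hp hp1 hu hN (Finset.some_mem_insertNone.2 hj)
    (lt_of_lt_of_le ?_ (hN none Finset.none_mem_insertNone))
  refine sum_mul_lt_sum_mul hq hq1 fun β hβ => ?_
  rcases β with _ | l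
  · simp [stageGame]; linarith
  · rw [Finset.some_mem_insertNone] at hβ
    have h2 := hyj l hβ
    by_cases hlj : l = j
    · subst hlj
      simp [stageGame]; linarith
    · simp [stageGame, hlj]; linarith

/-- `P` and `Q` are passing probabilities, and the bracket is the gain from passing instead of
bidding against an opponent who passes with probability `Q`. If `P < Q`, the first player must not
strictly prefer to pass and the second must not strictly prefer to bid. But the gain increases with
the opponent's passing probability, a contradiction. -/
theorem eq_of_two_by_two_nash {x c z P Q : ℝ} (hP : 0 ≤ P) (hQ : 0 ≤ Q)
    (hc : c < x) (hz : (x + c) / 2 ≤ z)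
    (h1 : (1 - P) * (Q * (z - (x + c) / 2) - (x - c) / 2) ≤ 0)
    (h2 : 0 ≤ P * (Q * (z - (x + c) / 2) - (x - c) / 2))
    (h1' : (1 - Q) * (P * (z - (x + c) / 2) - (x - c) / 2) ≤ 0)
    (h2' : 0 ≤ Q * (P * (z - (x + c) / 2) - (x - c) / 2))
    (hP1 : P ≤ 1) (hQ1 : Q ≤ 1) : P = Q := by
  have key : ∀ {P Q : ℝ}, 0 ≤ P → Q ≤ 1 →
      (1 - P) * (Q * (z - (x + c) / 2) - (x - c) / 2) ≤ 0 →
      0 ≤ Q * (P * (z - (x + c) / 2) - (x - c) / 2) → Q ≤ P := by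
    intro P Q hP hQ1 h1 h2'
    by_contra! hlt
    have a1 := nonpos_of_mul_nonpos_right h1 (by linarith : 0 < 1 - P)
    have a2 := nonneg_of_mul_nonneg_right h2' (by linarith : 0 < Q)
    -- With slope zero the gain would be the constant `-(x - c) / 2 < 0`, contradicting `a2`.
    have hs : 0 < z - (x + c) / 2 := by
      refine lt_of_le_of_ne (by linarith) fun h => ?_
      rw [← h] at a2
      linarith
    have := mul_lt_mul_of_pos_right hlt hs
    linarith
  exact le_antisymm (key hQ hP1 h1' h2) (key hP hQ1 h1 h2')

/-- The sign of `v m - y m` decides: below zero bidding is dominated, at zero the balanced bounds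
apply, and above zero the game reduces to two actions. The last conjunct is what forces the tie in
the upper bound, since `z < v m` excludes any passing. -/
theorem stageGame_nash (hm : m ∈ S) (hvm : ∀ j ∈ S, v j ≤ v m)
    (hv : ∀ j ∈ S, j ≠ m → v j ≤ y m) (hym : ∀ j ∈ S, y m ≤ y j)
    (hyv : ∀ j ∈ S, j ≠ m → v m ≤ y j) (hsum : ∀ j ∈ S, y j + v j ≤ y m + v m)
    (hz : (v m + y m) / 2 ≤ z)
    (hp : ∀ α ∈ Finset.insertNone S, 0 ≤ p α) (hp1 : ∑ α ∈ Finset.insertNone S, p α = 1)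
    (hq : ∀ α ∈ Finset.insertNone S, 0 ≤ q α) (hq1 : ∑ α ∈ Finset.insertNone S, q α = 1)
    (hu : u = ∑ α ∈ Finset.insertNone S, p α *
      ∑ β ∈ Finset.insertNone S, q β * stageGame v y z α β)
    (hN : ∀ α ∈ Finset.insertNone S, ∑ β ∈ Finset.insertNone S, q β * stageGame v y z α β ≤ u)
    (hu' : u' = ∑ α ∈ Finset.insertNone S, q α *
      ∑ β ∈ Finset.insertNone S, p β * stageGame v y z α β)
    (hN' : ∀ α ∈ Finset.insertNone S, ∑ β ∈ Finset.insertNone S, p β * stageGame v y z α β ≤ u') :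
    u = u' ∧ (v m < y m → u = z) ∧ (y m ≤ v m → (v m + y m) / 2 ≤ u) ∧ u ≤ z ∧
      (y m < v m → z < v m → u = (v m + y m) / 2) := by
  have hn : none ∈ Finset.insertNone S := Finset.none_mem_insertNone
  have hsm : some m ∈ Finset.insertNone S := Finset.some_mem_insertNone.2 hm
  rcases lt_trichotomy (v m) (y m) with h | h | h
  · have p0 := fun j (hj : j ∈ S) => weight_bid_eq_zero hvm h hym hz hp hp1 hq hq1 hu hN hj
    have q0 := fun j (hj : j ∈ S) => weight_bid_eq_zero hvm h hym hz hq hq1 hp hp1 hu' hN' hj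
    rw [Finset.sum_insertNone, Finset.sum_eq_zero p0, add_zero] at hp1
    rw [Finset.sum_insertNone, Finset.sum_eq_zero q0, add_zero] at hq1
    rw [sum_insertNone_of_forall_eq_zero hm fun j hj _ => p0 j hj,
      sum_insertNone_of_forall_eq_zero hm fun j hj _ => q0 j hj, p0 m hm, q0 m hm, hp1, hq1] at hu
    rw [sum_insertNone_of_forall_eq_zero hm fun j hj _ => q0 j hj,
      sum_insertNone_of_forall_eq_zero hm fun j hj _ => p0 j hj, p0 m hm, q0 m hm, hp1, hq1] at hu'
    simp only [stageGame, one_mul, zero_mul, add_zero] at hu hu'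
    exact ⟨hu.trans hu'.symm, fun _ => hu, fun h' => by linarith, hu.le, fun h' => by linarith⟩
  · have hzm : v m ≤ z := by linarith
    have hyj : ∀ j ∈ S, v m ≤ y j := fun j hj => h.trans_le (hym j hj)
    have p0 := fun j (hj : j ∈ S) => weight_eq_zero_of_balanced h hyj hsum hzm
      hp hp1 hq hq1 hu hN hj
    have q0 := fun j (hj : j ∈ S) => weight_eq_zero_of_balanced h hyj hsum hzm
      hq hq1 hp hp1 hu' hN' hj
    obtain ⟨h1, h2⟩ := le_and_le_of_balanced h hyj hvm hsum hp hp1 hq hq1 hu hN q0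
    obtain ⟨h1', h2'⟩ := le_and_le_of_balanced h hyj hvm hsum hq hq1 hp hp1 hu' hN' p0
    have hpn := hp _ hn
    have hqn := hq _ hn
    have hpl : p none ≤ 1 := hp1 ▸ Finset.single_le_sum hp hn
    have hql : q none ≤ 1 := hq1 ▸ Finset.single_le_sum hq hn
    have ha := mul_nonneg hpn (sub_nonneg.2 hzm)
    have hb := mul_nonneg hqn (sub_nonneg.2 hzm)
    -- The two bounds on each payoff force the bonuses `p q d`, `q d` and `p d` to agree, where `d =
    -- z - v m` and `p`, `q` are the passing probabilities. Hence both payoffs are equal.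
    have e1 : p none * (q none * (z - v m)) = q none * (z - v m) := by
      nlinarith [mul_nonneg (sub_nonneg.2 hpl) hb]
    have e2 : q none * (p none * (z - v m)) = p none * (z - v m) := by
      nlinarith [mul_nonneg (sub_nonneg.2 hql) ha]
    have e3 : p none * (q none * (z - v m)) = q none * (p none * (z - v m)) := by ring
    refine ⟨by linarith, fun h' => by linarith, fun _ => by linarith, ?_, fun h' => by linarith⟩
    nlinarith [mul_nonneg (sub_nonneg.2 hql) (sub_nonneg.2 hzm)]
  · have p0 := fun j (hj : j ∈ S) => weight_other_eq_zero hm h hv hyv hz hp hp1 hq hq1 hu hN hj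
    have q0 := fun j (hj : j ∈ S) => weight_other_eq_zero hm h hv hyv hz hq hq1 hp hp1 hu' hN' hj
    have fp := sum_insertNone_of_forall_eq_zero hm p0
    have fq := sum_insertNone_of_forall_eq_zero hm q0
    have hp1' := fp fun _ => 1
    have hq1' := fq fun _ => 1
    simp only [mul_one, hp1, hq1] at hp1' hq1'
    have n1 := hN _ hn
    have n2 := hN _ hsm
    have n1' := hN' _ hn
    have n2' := hN' _ hsm
    have hpn := hp _ hn
    have hqn := hq _ hn
    have hpm := hp _ hsm
    have hqm := hq _ hsm
    rw [fp, fq, fq] at hu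
    rw [fq, fp, fp] at hu'
    rw [fq] at n1 n2
    rw [fp] at n1' n2'
    simp only [stageGame, reduceCtorEq, if_false, if_true] at hu hu' n1 n2 n1' n2'
    have hT : q (some m) = 1 - q none := by linarith
    have hR : p (some m) = 1 - p none := by linarith
    rw [hT] at hu hu' n1 n2 hqm
    rw [hR] at hu hu' n1' n2' hpm
    generalize p none = P at *
    generalize q none = Q at *
    -- Passing minus the equilibrium payoff equals `1 - P` times the gain from passing; the
    -- equilibrium payoff minus bidding equals `P` times it. The same holds with the roles
    -- exchanged.
    have d1 : (1 - P) * (Q * (z - (v m + y m) / 2) - (v m - y m) / 2) ≤ 0 := by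
      rw [hu] at n1; linarith
    have d2 : 0 ≤ P * (Q * (z - (v m + y m) / 2) - (v m - y m) / 2) := by
      rw [hu] at n2; linarith
    have d1' : (1 - Q) * (P * (z - (v m + y m) / 2) - (v m - y m) / 2) ≤ 0 := by
      rw [hu'] at n1'; linarith
    have d2' : 0 ≤ Q * (P * (z - (v m + y m) / 2) - (v m - y m) / 2) := by
      rw [hu'] at n2'; linarith
    obtain rfl : P = Q := eq_of_two_by_two_nash hpn hqn h hz d1 d2 d1' d2'
      (by linarith) (by linarith)
    refine ⟨by linarith, fun h' => by linarith, fun _ => ?_, ?_, fun _ hzx => ?_⟩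
    · nlinarith [mul_nonneg hpn (sub_nonneg.2 h.le)]
    · nlinarith [mul_nonneg (mul_nonneg (by linarith : 0 ≤ 1 + P) hpm) (sub_nonneg.2 hz)]
    -- If `P` were positive, the gain from passing would have to be nonnegative, but `z < v m` makes
    -- it negative for every `P ≤ 1`.
    · obtain rfl | hP := hpn.eq_or_lt
      · linarith
      · have := nonneg_of_mul_nonneg_right d2 hP
        nlinarith [mul_nonneg hpn (sub_nonneg.2 hzx.le)]

end StageGame

/-! ### Bounds on equilibrium payoffs by backward induction. -/

section Deviations

variable {μ : Measure ℝ} {σ : (i : Fin 2) → Strategy i} {k t : ℕ} {x : Fin (t + 2) → ℝ}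
  {r : List StageRecord} {i j : Fin 2}

/-- The strategy of playing the action `f t x r` after the history `(x, r)`. -/
noncomputable def pureStrategy (i : Fin 2)
    (f : (t : ℕ) → (Fin (t + 2) → ℝ) → List StageRecord → Option ℕ)
    (hf : ∀ t r α, MeasurableSet {x | f t x r = α}) (hfeas : ∀ t x r, f t x r ∈ feasible i t r) :
    Strategy i where
  act t x r α := open Classical in if f t x r = α then 1 else 0
  measurable_act t r α := by
    classical
    exact Measurable.ite (hf t r α) measurable_const measurable_const
  act_nonneg t x r α := by split_ifs <;> norm_num
  act_eq_zero t x r α hα := by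
    refine if_neg fun h => hα ?_
    rw [← h]
    exact hfeas t x r
  sum_act t x r := by simp [hfeas t x r]

theorem pureStrategy_act {f : (t : ℕ) → (Fin (t + 2) → ℝ) → List StageRecord → Option ℕ}
    (hf : ∀ t r α, MeasurableSet {x | f t x r = α}) (hfeas : ∀ t x r, f t x r ∈ feasible i t r) :
    (pureStrategy i f hf hfeas).act t x r (f t x r) = 1 :=
  if_pos rfl

/-- The strategy of never bidding. -/
noncomputable def passStrategy (i : Fin 2) : Strategy i :=
  pureStrategy i (fun _ _ _ => none) (fun _ _ _ => MeasurableSet.const _)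
    fun t _ r => none_mem_feasible i t r

/-- Follow `s` except at stage `t`, where the action is `α` whenever this is feasible. -/
noncomputable def Strategy.deviate (s : Strategy i) (t : ℕ) (α : Option ℕ) : Strategy i where
  act t' x r β := if t' = t then
      (if β = (if α ∈ feasible i t' r then α else none) then 1 else 0) else s.act t' x r β
  measurable_act t' r β := by
    split_ifs
    · exact measurable_const
    · exact measurable_const
    · exact measurable_const
    · exact measurable_const
    · exact s.measurable_act t' r β
  act_nonneg t' x r β := by
    by_cases h : t' = t
    · rw [if_pos h]; split_ifs <;> norm_num
    · rw [if_neg h]; exact s.act_nonneg t' x r β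
  act_eq_zero t' x r β hβ := by
    by_cases h : t' = t
    · rw [if_pos h, if_neg]
      rintro rfl
      split_ifs at hβ with h'
      · exact hβ h'
      · exact hβ (none_mem_feasible i t' r)
    · rw [if_neg h]; exact s.act_eq_zero t' x r β hβ
  sum_act t' x r := by
    by_cases h : t' = t
    · simp only [if_pos h, Finset.sum_ite_eq']
      rw [if_pos]
      split_ifs with h'
      · exact h'
      · exact none_mem_feasible i t' r
    · simp only [if_neg h]; exact s.sum_act t' x r

theorem expectedPayoff_congr {σ' : (i : Fin 2) → Strategy i}
    (h : ∀ i, ∀ t' ≥ t, (σ i).act t' = (σ' i).act t') :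
    expectedPayoff μ σ k t x r i = expectedPayoff μ σ' k t x r i := by
  induction k generalizing t r with
  | zero => rfl
  | succ k ih =>
    simp only [expectedPayoff]
    simp only [h 0 t le_rfl, h 1 t le_rfl,
      fun y r' => ih (x := addSample x y) (r := r') fun i t' ht' => h i t' (by omega)]

/-- The deviation changes play only at stage `t`, so by `expectedPayoff_congr` all continuation
payoffs are those of `σ`. The Nash property thus yields the pure best-response inequalities of the
stage. -/
theorem IsNashAfter.sum_le (h : IsNashAfter μ σ (k + 1) t x r) (hij : i ≠ j) {α : Option ℕ}
    (hα : α ∈ feasible i t r) :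
    ∑ β ∈ feasible j t r, (σ j).act t x r β * bidPayoff μ σ k t x r i (joint i α β) ≤
      expectedPayoff μ σ (k + 1) t x r i := by
  refine le_trans (le_of_eq ?_) (h i ((σ i).deviate t α))
  set σ' := Function.update σ i ((σ i).deviate t α) with hσ'
  have hi : σ' i = (σ i).deviate t α := Function.update_self _ _ _
  have hj : σ' j = σ j := Function.update_of_ne hij.symm _ _
  have hact : (σ' i).act t x r α = 1 := by
    rw [hi]; simp [Strategy.deviate, hα]
  rw [expectedPayoff_succ hij, (σ' i).sum_act_mul_eq hact, hj]
  refine Finset.sum_congr rfl fun β _ => ?_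
  simp only [bidPayoff, allocPayoff]
  have := fun y (r' : List StageRecord) => expectedPayoff_congr (μ := μ) (k := k) (t := t + 1)
    (x := addSample x y) (r := r') (i := i) (σ := σ) (σ' := σ') <|
    (forall_fin_two_iff hij).2 ⟨fun t' ht' => by
      rw [hi]
      have : t' ≠ t := by omega
      simp [Strategy.deviate, this], fun t' _ => by rw [hj]⟩
  simp only [this]

variable [IsProbabilityMeasure μ] {n : ℕ} {a b : ℝ}

theorem IsSPE.expectedPayoff_alone (hμ : μ (Set.Icc (0 : ℝ) 1)ᶜ = 0) (hσ : IsSPE μ n a b σ)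
    (hn : t + k = n) (hist : IsHistory a b t x r) (hij : i ≠ j) (hi : holding r i = none)
    (hj : holding r j ≠ none) :
    expectedPayoff μ σ k t x r i = waitValue μ k (bestValue (itemValue x) (available t r)) := by
  refine le_antisymm
    (expectedPayoff_alone_le hμ σ k hist.mem_Icc hij hist.lt_of_holding hi hj) ?_
  have h := hσ t (by omega) x r hist i (passStrategy i)
  rw [show n - t = k by omega] at h
  refine le_trans (le_of_eq ?_) h
  refine (expectedPayoff_alone_eq hμ hij (fun t x r _ _ => ?_) k hist.mem_Icc hist.lt_of_holding
    hi hj).symm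
  rw [Function.update_self]
  exact pureStrategy_act (f := fun _ _ _ => none) _ _

theorem IsSPE.bidPayoff_eq_stageGame (hμ : μ (Set.Icc (0 : ℝ) 1)ᶜ = 0) (hσ : IsSPE μ n a b σ)
    (hn : t + (k + 1) = n) (hist : IsHistory a b t x r) (h : ∀ i, holding r i = none)
    {α β : Option ℕ} (hα : α ∈ feasible i t r) (hβ : β ∈ feasible i t r) :
    bidPayoff μ σ k t x r i (joint i α β) = stageGame (itemValue x)
      (fun l => waitValue μ (k + 1) (bestValue (itemValue x) ((Finset.range (t + 2)).erase l)))
      (allocPayoff μ σ k t x r i (joint i none none) (joint i none none)) α β := by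
  obtain ⟨j, hij⟩ : ∃ j, i ≠ j := (exists_ne i).imp fun _ h => h.symm
  have hfe : feasible j t r = feasible i t r := by
    rw [feasible_of_forall_eq_none h, feasible_of_forall_eq_none h]
  have hbid : ∀ {α β}, α ∈ feasible i t r → β ∈ feasible i t r →
      ∀ i', joint i α β i' ∈ feasible i' t r := fun {α β} hα hβ => by
    refine (forall_fin_two_iff hij).2 ⟨?_, ?_⟩
    · rwa [joint_self]
    · rwa [joint_of_ne hij, hfe]
  have htaken : ∀ {l : ℕ} {bid : Fin 2 → Option ℕ}, l < t + 2 →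
      (∀ i', bid i' ∈ feasible i' t r) → joint i none (some l) ∈ allocations bid →
      allocPayoff μ σ k t x r i bid (joint i none (some l)) =
        waitValue μ (k + 1) (bestValue (itemValue x) ((Finset.range (t + 2)).erase l)) :=
    fun {l bid} hl hb hg => allocPayoff_taken_eq hμ hist.mem_Icc h hl fun y hy => by
      obtain ⟨-, h2, h3⟩ := holding_cons_taken hij h hl bid
      exact hσ.expectedPayoff_alone hμ (by omega) (hist.cons hy hb hg) hij h2 h3
  rcases α with _ | l
  · rw [bidPayoff_of_not i (by simp)]
    rcases β with _ | l
    · rfl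
    · exact htaken (lt_of_mem_feasible hβ) (hbid hα hβ)
        (by rw [allocations_joint_of_not i (by simp), Finset.mem_singleton])
  · have hl := lt_of_mem_feasible hα
    by_cases hβl : β = some l
    · subst hβl
      rw [bidPayoff_same_eq hl, htaken hl (hbid hα hβ) (by simp [allocations_joint_same])]
      simp [stageGame]
    · rw [bidPayoff_some_of_ne hl hβl]
      simp [stageGame, hβl]

/-- Equality of the payoffs is part of the induction because it makes the stage game symmetric: both
players then have the same continuation `z` after two passes. -/
theorem IsSPE.expectedPayoff_bounds (hμ : μ (Set.Icc (0 : ℝ) 1)ᶜ = 0) (hσ : IsSPE μ n a b σ)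
    (k : ℕ) (hn : t + k = n) (hist : IsHistory a b t x r) (h : ∀ i, holding r i = none) :
    expectedPayoff μ σ k t x r 0 = expectedPayoff μ σ k t x r 1 ∧
      regionValue μ (LowPass μ) k (topTwo x).1 (topTwo x).2 ≤ expectedPayoff μ σ k t x r 0 ∧
      expectedPayoff μ σ k t x r 0 ≤ highValue μ k (topTwo x).1 (topTwo x).2 := by
  induction k generalizing t r with
  | zero =>
    have : ∀ i, expectedPayoff μ σ 0 t x r i = ((topTwo x).1 + (topTwo x).2) / 2 := fun i => by
      simp only [expectedPayoff, finalPayoff, h, topTwo, available_of_forall_eq_none h]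
      simp
    rw [this, this]
    exact ⟨rfl, le_rfl, le_rfl⟩
  | succ k ih =>
    have hx := hist.mem_Icc
    have hv := itemValue_mem_Icc hx
    set S := Finset.range (t + 2) with hS
    set v := itemValue x with hvdef
    set w : ℕ → ℝ := fun l => waitValue μ (k + 1) (bestValue v (S.erase l)) with hw
    set bid : Fin 2 → Option ℕ := joint 0 none none with hbid
    set z := allocPayoff μ σ k t x r 0 bid bid with hzdef
    have hbid1 : joint 1 none none = bid := joint_swap (by decide) _ _
    have hnext : ∀ y ∈ Set.Icc (0 : ℝ) 1, IsHistory a b (t + 1) (addSample x y) (⟨bid, bid⟩ :: r) :=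
      fun y hy => hist.cons hy (fun i => by simpa [hbid, joint] using none_mem_feasible i t r)
        (by rw [hbid, allocations_joint_of_not 0 (by simp), Finset.mem_singleton])
    have hIH := fun y hy => ih (by omega) (hnext y hy)
      (fun i => by rw [hbid, holding_cons_none]; exact h i)
    have hz1 : allocPayoff μ σ k t x r 1 bid bid = z :=
      integral_congr_of_Icc hμ fun y hy => (hIH y hy).1.symm
    have ha := topTwo_fst_mem_Icc hx
    have hb := topTwo_snd_mem_Icc hx
    have hzi := integrable_expectedPayoff hμ σ k hx (⟨bid, bid⟩ :: r) 0
    have hzl : ∫ y, regionValue μ (LowPass μ) k (max (topTwo x).1 y)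
        (med (topTwo x).1 (topTwo x).2 y) ∂μ ≤ z := by
      refine integral_mono_of_Icc hμ
        (integrable_regionValue hμ measurableSet_lowPass k ha hb) hzi fun y hy => ?_
      have := (hIH y hy).2.1
      rwa [topTwo_addSample hx hy] at this
    have hzh : z ≤ ∫ y, highValue μ k (max (topTwo x).1 y)
        (med (topTwo x).1 (topTwo x).2 y) ∂μ := by
      simp only [← regionValue_highPass]
      refine integral_mono_of_Icc hμ hzi
        (integrable_regionValue hμ measurableSet_highPass k ha hb) fun y hy => ?_
      have := (hIH y hy).2.2
      rwa [topTwo_addSample hx hy, ← regionValue_highPass] at this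
    -- The bound on `z` is taken through the lower recursion, which itself dominates the tie value.
    have hhalf : ((topTwo x).1 + waitValue μ (k + 1) (topTwo x).2) / 2 ≤ z := by
      refine le_trans ?_ hzl
      exact half_add_waitValue_le_integral hμ k ha hb (topTwo_snd_le_fst hx)
        (integrable_regionValue hμ measurableSet_lowPass k ha hb) fun y hy =>
          half_add_waitValue_le_regionValue hμ measurableSet_lowPass k (max_mem_Icc ha hy)
            (med_mem_Icc ha hb hy) (med_le_max (topTwo_snd_le_fst hx) y)
    obtain ⟨m, hm, hmv, hmax⟩ := exists_bestValue_eq v (S := S) ⟨0, by simp [hS]⟩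
    have hfst : (topTwo x).1 = v m := hmv.symm
    have hsnd : (topTwo x).2 = bestValue v (S.erase m) := secondValue_eq hm hmax
    have hbI : ∀ l, bestValue v (S.erase l) ∈ Set.Icc (0 : ℝ) 1 := fun l => bestValue_mem_Icc hv _
    have hlm : ∀ l, l ≠ m → bestValue v (S.erase l) = v m := fun l hl =>
      bestValue_eq (Finset.mem_erase.2 ⟨hl.symm, hm⟩)
        fun l' hl' => hmax l' (Finset.mem_of_mem_erase hl')
    have hle : bestValue v (S.erase m) ≤ v m := by
      rw [hmv]; exact bestValue_mono (fun l => (hv l).1) (Finset.erase_subset _ _)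
    have hwm : waitValue μ (k + 1) (topTwo x).2 = w m := by rw [hsnd]
    rw [regionValue, highValue, H, LowPass]
    rw [hwm, hfst] at hhalf ⊢
    rw [hfst] at hzl hzh
    have hfe : ∀ i, feasible i t r = Finset.insertNone S := feasible_of_forall_eq_none h
    have hnash : IsNashAfter μ σ (k + 1) t x r := by
      have := hσ t (by omega) x r hist
      rwa [show n - t = k + 1 by omega] at this
    have g0 : ∀ α ∈ Finset.insertNone S, ∀ β ∈ Finset.insertNone S,
        bidPayoff μ σ k t x r 0 (joint 0 α β) = stageGame v w z α β := fun α hα β hβ =>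
      hσ.bidPayoff_eq_stageGame hμ hn hist h (by rwa [hfe]) (by rwa [hfe])
    have g1 : ∀ α ∈ Finset.insertNone S, ∀ β ∈ Finset.insertNone S,
        bidPayoff μ σ k t x r 1 (joint 1 α β) = stageGame v w z α β := fun α hα β hβ => by
      rw [hσ.bidPayoff_eq_stageGame hμ hn hist h (by rwa [hfe]) (by rwa [hfe]), hbid1, hz1]
    have h01 : (0 : Fin 2) ≠ 1 := by decide
    have s0 : ∀ α ∈ Finset.insertNone S, ∑ β ∈ Finset.insertNone S, (σ 1).act t x r β *
        bidPayoff μ σ k t x r 0 (joint 0 α β) =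
        ∑ β ∈ Finset.insertNone S, (σ 1).act t x r β * stageGame v w z α β :=
      fun α hα => Finset.sum_congr rfl fun β hβ => by rw [g0 α hα β hβ]
    have s1 : ∀ α ∈ Finset.insertNone S, ∑ β ∈ Finset.insertNone S, (σ 0).act t x r β *
        bidPayoff μ σ k t x r 1 (joint 1 α β) =
        ∑ β ∈ Finset.insertNone S, (σ 0).act t x r β * stageGame v w z α β :=
      fun α hα => Finset.sum_congr rfl fun β hβ => by rw [g1 α hα β hβ]
    have u0 := expectedPayoff_succ (μ := μ) (σ := σ) (k := k) (t := t) (x := x) (r := r) h01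
    have u1 := expectedPayoff_succ (μ := μ) (σ := σ) (k := k) (t := t) (x := x) (r := r) h01.symm
    have n0 := fun α hα => hnash.sum_le h01 (α := α) hα
    have n1 := fun α hα => hnash.sum_le h01.symm (α := α) hα
    rw [hfe, hfe, Finset.sum_congr rfl fun α hα => by rw [s0 α hα]] at u0
    rw [hfe, hfe, Finset.sum_congr rfl fun α hα => by rw [s1 α hα]] at u1
    simp only [hfe] at n0 n1
    obtain ⟨c1, c2, c3, c4, c5⟩ := stageGame_nash (z := z) (y := w) (v := v) hm hmax
      (fun l hl hlm => (le_bestValue (Finset.mem_erase.2 ⟨hlm, hl⟩)).trans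
        (le_waitValue hμ _ (hbI m)))
      (fun l hl => waitValue_mono hμ _ (hbI m) (hbI l) (by
        by_cases h' : l = m
        · rw [h']
        · rwa [hlm l h']))
      (fun l hl h' => by
        rw [← hlm l h']
        exact le_waitValue hμ (k + 1) (hbI l))
      -- For `l ≠ m`, losing `l` leaves the highest value and losing `m` only the second. The
      -- Lipschitz bound limits the gain in waiting value by the difference of these two, and item
      -- `l` is worth at most the second.
      (fun l hl => by
        by_cases h' : l = m
        · rw [h']
        · have h1 := waitValue_le_add hμ (k + 1) (hbI m) (hv m) hle
          have h2 := le_bestValue (v := v) (Finset.mem_erase.2 ⟨h', hl⟩)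
          simp only [hw, hlm l h']
          linarith)
      hhalf (fun α _ => (σ 0).act_nonneg t x r α) (hfe 0 ▸ (σ 0).sum_act t x r)
      (fun α _ => (σ 1).act_nonneg t x r α) (hfe 1 ▸ (σ 1).sum_act t x r)
      u0 (fun α hα => s0 α hα ▸ n0 α hα) u1 (fun α hα => s1 α hα ▸ n1 α hα)
    refine ⟨c1, ?_, ?_⟩
    · split_ifs with hlt
      · rw [c2 hlt]; exact hzl
      · exact c3 (not_lt.1 hlt)
    · split_ifs with hlt
      · exact c4.trans hzh
      · obtain ⟨h1, h2⟩ := max_lt_iff.1 (not_le.1 hlt)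
        exact (c5 h1 (lt_of_le_of_lt hzh h2)).le

end Deviations

/-! ### Symmetric pure equilibria attaining the bounds. -/

section RegionStrategies

variable {μ : Measure ℝ} {pass : ℕ → ℝ → ℝ → Prop} {n k t : ℕ}
  {x : Fin (t + 2) → ℝ} {r : List StageRecord} {i j : Fin 2}

theorem exists_index_eq_top (x : Fin (t + 2) → ℝ) :
    ∃ j, j < t + 2 ∧ itemValue x j = (topTwo x).1 := by
  obtain ⟨j, hj, h, -⟩ := exists_bestValue_eq (itemValue x) (S := Finset.range (t + 2))
    ⟨0, by simp⟩
  exact ⟨j, Finset.mem_range.1 hj, h⟩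

open Classical in
/-- The first item of highest value. -/
noncomputable def firstBest (x : Fin (t + 2) → ℝ) : ℕ := Nat.find (exists_index_eq_top x)

theorem firstBest_lt (x : Fin (t + 2) → ℝ) : firstBest x < t + 2 := by
  classical exact (Nat.find_spec (exists_index_eq_top x)).1

theorem itemValue_firstBest (x : Fin (t + 2) → ℝ) : itemValue x (firstBest x) = (topTwo x).1 := by
  classical exact (Nat.find_spec (exists_index_eq_top x)).2

/-- Choosing the smallest index among the maximizers makes the choice measurable, which an arbitrary
maximizer need not be. -/
theorem measurable_firstBest : Measurable fun x : Fin (t + 2) → ℝ => firstBest x := by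
  classical
  refine measurable_find _ fun j => ?_
  exact (MeasurableSet.const _).inter
    (measurableSet_eq_fun (measurable_itemValue j) measurable_topTwo.fst)

theorem itemValue_le_top (x : Fin (t + 2) → ℝ) {l : ℕ} (hl : l < t + 2) :
    itemValue x l ≤ (topTwo x).1 :=
  le_bestValue (Finset.mem_range.2 hl)

theorem bestValue_erase_firstBest (x : Fin (t + 2) → ℝ) :
    bestValue (itemValue x) ((Finset.range (t + 2)).erase (firstBest x)) = (topTwo x).2 :=
  (secondValue_eq (Finset.mem_range.2 (firstBest_lt x)) fun l hl => by
    rw [itemValue_firstBest]; exact itemValue_le_top x (Finset.mem_range.1 hl)).symm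

open Classical in
/-- Pass in the region `pass`, and otherwise bid for the best item if both players are present. -/
noncomputable def regionAction (pass : ℕ → ℝ → ℝ → Prop) (n t : ℕ) (x : Fin (t + 2) → ℝ)
    (r : List StageRecord) : Option ℕ :=
  if (∀ i, holding r i = none) ∧ ¬pass (n - t - 1) (topTwo x).1 (topTwo x).2
    then some (firstBest x) else none

theorem regionAction_of_holding (hj : holding r j ≠ none) : regionAction pass n t x r = none :=
  if_neg fun h => hj (h.1 j)

theorem measurableSet_regionAction (hp : ∀ k, MeasurableSet {q : ℝ × ℝ | pass k q.1 q.2}) (n t : ℕ)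
    (r : List StageRecord) (α : Option ℕ) :
    MeasurableSet {x : Fin (t + 2) → ℝ | regionAction pass n t x r = α} := by
  have h1 : MeasurableSet {x : Fin (t + 2) → ℝ |
      (∀ i, holding r i = none) ∧ ¬pass (n - t - 1) (topTwo x).1 (topTwo x).2} :=
    (MeasurableSet.const _).inter (measurable_topTwo (hp (n - t - 1))).compl
  rcases α with _ | l
  · convert h1.compl using 1
    ext x
    simp only [regionAction, Set.mem_ofPred_eq, Set.mem_compl_iff]
    split_ifs with h
    · simp [h]
    · exact iff_of_true rfl h
  · convert h1.inter (measurable_firstBest (measurableSet_singleton l)) using 1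
    ext x
    simp only [regionAction, Set.mem_ofPred_eq, Set.mem_inter_iff, Set.mem_preimage,
      Set.mem_singleton_iff]
    split_ifs with h
    · simp [h]
    · exact iff_of_false (by simp) fun h' => h h'.1

theorem regionAction_mem_feasible (n t : ℕ) (x : Fin (t + 2) → ℝ) (r : List StageRecord)
    (i : Fin 2) : regionAction pass n t x r ∈ feasible i t r := by
  unfold regionAction
  split_ifs with h
  · rw [feasible_of_forall_eq_none h.1, Finset.some_mem_insertNone]
    exact Finset.mem_range.2 (firstBest_lt x)
  · exact none_mem_feasible i t r

/-- The profile in which both players use `regionAction`. -/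
noncomputable def regionProfile (pass : ℕ → ℝ → ℝ → Prop)
    (hp : ∀ k, MeasurableSet {q : ℝ × ℝ | pass k q.1 q.2}) (n : ℕ) (i : Fin 2) : Strategy i :=
  pureStrategy i (regionAction pass n) (measurableSet_regionAction hp n)
    fun t x r => regionAction_mem_feasible n t x r i

theorem regionProfile_act (hp : ∀ k, MeasurableSet {q : ℝ × ℝ | pass k q.1 q.2}) (n t : ℕ)
    (x : Fin (t + 2) → ℝ) (r : List StageRecord) (i : Fin 2) :
    (regionProfile pass hp n i).act t x r (regionAction pass n t x r) = 1 :=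
  pureStrategy_act _ _

variable [IsProbabilityMeasure μ]

theorem expectedPayoff_regionProfile_alone (hμ : μ (Set.Icc (0 : ℝ) 1)ᶜ = 0)
    (hp : ∀ k, MeasurableSet {q : ℝ × ℝ | pass k q.1 q.2}) (n k : ℕ)
    (hx : ∀ j, x j ∈ Set.Icc (0 : ℝ) 1) (hij : i ≠ j)
    (hb : ∀ i l, holding r i = some l → l < t + 2) (hi : holding r i = none)
    (hj : holding r j ≠ none) :
    expectedPayoff μ (regionProfile pass hp n) k t x r i =
      waitValue μ k (bestValue (itemValue x) (available t r)) := by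
  refine expectedPayoff_alone_eq hμ hij (fun t x r _ hj => ?_) k hx hb hi hj
  have := regionProfile_act hp n t x r i
  rwa [regionAction_of_holding hj] at this

theorem expectedPayoff_regionProfile (hμ : μ (Set.Icc (0 : ℝ) 1)ᶜ = 0)
    (hp : ∀ k, MeasurableSet {q : ℝ × ℝ | pass k q.1 q.2}) (i : Fin 2) (k : ℕ) (hn : t + k = n)
    (hx : ∀ j, x j ∈ Set.Icc (0 : ℝ) 1) (h : ∀ i, holding r i = none) :
    expectedPayoff μ (regionProfile pass hp n) k t x r i =
      regionValue μ pass k (topTwo x).1 (topTwo x).2 := by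
  induction k generalizing t r with
  | zero =>
    simp only [expectedPayoff, finalPayoff, h, topTwo, available_of_forall_eq_none h, regionValue]
    simp
  | succ k ih =>
    obtain ⟨j, hij⟩ : ∃ j, i ≠ j := (exists_ne i).imp fun _ h => h.symm
    rw [expectedPayoff_succ hij, Strategy.sum_act_mul_eq _ (regionProfile_act hp n t x r i),
      Strategy.sum_act_mul_eq _ (regionProfile_act hp n t x r j), regionAction, regionValue]
    -- `pass k` governs the stage with `k + 1` samples still to come, hence the shift by one.
    have hk : n - t - 1 = k := by omega
    by_cases hpass : pass k (topTwo x).1 (topTwo x).2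
    · rw [if_neg (by rw [hk]; exact fun h => h.2 hpass), if_pos hpass,
        bidPayoff_of_not i (by simp), allocPayoff]
      refine integral_congr_of_Icc hμ fun y hy => ?_
      rw [ih (by omega) (addSample_mem_Icc hx hy) (by rwa [holding_cons_none]),
        topTwo_addSample hx hy]
    · rw [if_pos (by rw [hk]; exact ⟨h, hpass⟩), if_neg hpass, bidPayoff_same_eq (firstBest_lt x),
        itemValue_firstBest, allocPayoff_taken_eq hμ hx h (firstBest_lt x),
        bestValue_erase_firstBest]
      intro y hy
      obtain ⟨h1, h2, h3⟩ := holding_cons_taken hij h (firstBest_lt x) _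
      exact expectedPayoff_regionProfile_alone hμ hp n k (addSample_mem_Icc hx hy) hij h1 h2 h3

/-- Against a passing opponent, bidding gives at most the top value, which `hpass` bounds by the
continuation. Against a bid for the best item, passing or taking another item gives at most the
waiting value from the second value. By `hbid` this is no more than the tie. -/
theorem expectedPayoff_le_regionValue (hμ : μ (Set.Icc (0 : ℝ) 1)ᶜ = 0)
    (hp : ∀ k, MeasurableSet {q : ℝ × ℝ | pass k q.1 q.2})
    (hpass : ∀ k, ∀ a ∈ Set.Icc (0 : ℝ) 1, ∀ b ∈ Set.Icc (0 : ℝ) 1, b ≤ a → pass k a b →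
      a ≤ ∫ y, regionValue μ pass k (max a y) (med a b y) ∂μ)
    (hbid : ∀ k, ∀ a ∈ Set.Icc (0 : ℝ) 1, ∀ b ∈ Set.Icc (0 : ℝ) 1, b ≤ a → ¬pass k a b →
      waitValue μ (k + 1) b ≤ a)
    (hij : i ≠ j) {σ : (i : Fin 2) → Strategy i} (hσ : σ j = regionProfile pass hp n j)
    (k : ℕ) (hn : t + k = n) (hx : ∀ j, x j ∈ Set.Icc (0 : ℝ) 1) (h : ∀ i, holding r i = none) :
    expectedPayoff μ σ k t x r i ≤ regionValue μ pass k (topTwo x).1 (topTwo x).2 := by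
  induction k generalizing t r with
  | zero =>
    simp only [expectedPayoff, finalPayoff, h, topTwo, available_of_forall_eq_none h, regionValue]
    simp
  | succ k ih =>
    have ha := topTwo_fst_mem_Icc hx
    have hb := topTwo_snd_mem_Icc hx
    have hba := topTwo_snd_le_fst hx
    have hk : n - t - 1 = k := by omega
    rw [expectedPayoff_succ hij]
    refine (σ i).sum_act_mul_le fun α hα => ?_
    rw [hσ, Strategy.sum_act_mul_eq _ (regionProfile_act hp n t x r j), regionAction, regionValue]
    by_cases hps : pass k (topTwo x).1 (topTwo x).2
    · rw [if_neg (by rw [hk]; exact fun h => h.2 hps), if_pos hps]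
      rcases α with _ | l
      · rw [bidPayoff_of_not i (by simp), allocPayoff]
        refine integral_mono_of_Icc hμ (integrable_expectedPayoff hμ σ k hx _ i)
          (integrable_regionValue hμ hp k ha hb) fun y hy => ?_
        rw [← Prod.mk.eta (p := topTwo x)]
        have := ih (r := ⟨joint i none none, joint i none none⟩ :: r) (by omega)
          (addSample_mem_Icc hx hy) (by rwa [holding_cons_none])
        rwa [topTwo_addSample hx hy] at this
      · have hl := lt_of_mem_feasible hα
        rw [bidPayoff_some_of_ne hl (by simp)]
        exact (itemValue_le_top x hl).trans (hpass k _ ha _ hb hba hps)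
    · rw [if_pos (by rw [hk]; exact ⟨h, hps⟩), if_neg hps]
      have hw := hbid k _ ha _ hb hba hps
      have htaken := fun bid => allocPayoff_taken_le hμ σ k hx h (i := i) (firstBest_lt x) bid
      rw [bestValue_erase_firstBest] at htaken
      rcases α with _ | l
      · rw [bidPayoff_of_not i (by simp)]
        exact (htaken _).trans (by linarith)
      · have hl := lt_of_mem_feasible hα
        by_cases hlm : l = firstBest x
        · subst hlm
          rw [bidPayoff_same_eq hl, itemValue_firstBest]
          linarith [htaken (joint i (some (firstBest x)) (some (firstBest x)))]
        · rw [bidPayoff_some_of_ne hl (by simpa using Ne.symm hlm)]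
          have h1 : itemValue x l ≤ (topTwo x).2 := by
            rw [← bestValue_erase_firstBest]
            exact le_bestValue (Finset.mem_erase.2 ⟨hlm, Finset.mem_range.2 hl⟩)
          have h2 := le_waitValue hμ (k + 1) hb
          linarith

/-- Histories are of three kinds for a player: both present, alone, or already gone. They are
settled by the best-response bound, the optimality of waiting, and the constancy of his payoff. -/
theorem isSPE_regionProfile (hμ : μ (Set.Icc (0 : ℝ) 1)ᶜ = 0)
    (hp : ∀ k, MeasurableSet {q : ℝ × ℝ | pass k q.1 q.2})
    (hpass : ∀ k, ∀ a ∈ Set.Icc (0 : ℝ) 1, ∀ b ∈ Set.Icc (0 : ℝ) 1, b ≤ a → pass k a b →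
      a ≤ ∫ y, regionValue μ pass k (max a y) (med a b y) ∂μ)
    (hbid : ∀ k, ∀ a ∈ Set.Icc (0 : ℝ) 1, ∀ b ∈ Set.Icc (0 : ℝ) 1, b ≤ a → ¬pass k a b →
      waitValue μ (k + 1) b ≤ a) (n : ℕ) (a b : ℝ) :
    IsSPE μ n a b (regionProfile pass hp n) := by
  intro t ht x r hist i τ
  obtain ⟨j, hij⟩ : ∃ j, i ≠ j := (exists_ne i).imp fun _ h => h.symm
  rcases hi : holding r i with _ | l
  · by_cases hj : holding r j = none
    · have h : ∀ i, holding r i = none := (forall_fin_two_iff hij).2 ⟨hi, hj⟩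
      rw [expectedPayoff_regionProfile hμ hp i _ (by omega) hist.mem_Icc h]
      exact expectedPayoff_le_regionValue hμ hp hpass hbid hij
        (Function.update_of_ne hij.symm _ _) _ (by omega) hist.mem_Icc h
    · rw [expectedPayoff_regionProfile_alone hμ hp n _ hist.mem_Icc hij hist.lt_of_holding hi hj]
      exact expectedPayoff_alone_le hμ _ _ hist.mem_Icc hij hist.lt_of_holding hi hj
  · have hl := hist.lt_of_holding i l hi
    rw [expectedPayoff_of_holding _ _ hi hl, expectedPayoff_of_holding _ _ hi hl]

theorem regionValue_mem_spePayoffs (hμ : μ (Set.Icc (0 : ℝ) 1)ᶜ = 0)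
    (hp : ∀ k, MeasurableSet {q : ℝ × ℝ | pass k q.1 q.2})
    (hpass : ∀ k, ∀ a ∈ Set.Icc (0 : ℝ) 1, ∀ b ∈ Set.Icc (0 : ℝ) 1, b ≤ a → pass k a b →
      a ≤ ∫ y, regionValue μ pass k (max a y) (med a b y) ∂μ)
    (hbid : ∀ k, ∀ a ∈ Set.Icc (0 : ℝ) 1, ∀ b ∈ Set.Icc (0 : ℝ) 1, b ≤ a → ¬pass k a b →
      waitValue μ (k + 1) b ≤ a) (n : ℕ) {a b : ℝ} (hba : b ≤ a)
    (hx : ∀ j, (![a, b] : Fin (0 + 2) → ℝ) j ∈ Set.Icc (0 : ℝ) 1) :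
    regionValue μ pass n a b ∈ Prod.fst '' spePayoffs μ n a b := by
  refine ⟨_, ⟨regionProfile pass hp n, isSPE_regionProfile hμ hp hpass hbid n a b, rfl⟩, ?_⟩
  rw [expectedPayoff_regionProfile hμ hp 0 n (zero_add n) hx fun _ => rfl, topTwo_initial hba]

theorem half_add_waitValue_le_integral_regionValue (hμ : μ (Set.Icc (0 : ℝ) 1)ᶜ = 0)
    (hp : ∀ k, MeasurableSet {q : ℝ × ℝ | pass k q.1 q.2}) (k : ℕ) {a b : ℝ}
    (ha : a ∈ Set.Icc (0 : ℝ) 1) (hb : b ∈ Set.Icc (0 : ℝ) 1) (hba : b ≤ a) :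
    (a + waitValue μ (k + 1) b) / 2 ≤ ∫ y, regionValue μ pass k (max a y) (med a b y) ∂μ :=
  half_add_waitValue_le_integral hμ k ha hb hba (integrable_regionValue hμ hp k ha hb)
    fun y hy => half_add_waitValue_le_regionValue hμ hp k (max_mem_Icc ha hy)
      (med_mem_Icc ha hb hy) (med_le_max hba y)

end RegionStrategies

end FullRecall

/-! ### The two extreme equilibria and the conclusion. -/

theorem mainTheorem1 (μ : Measure ℝ) [IsProbabilityMeasure μ] (hμ : μ (Set.Icc (0 : ℝ) 1)ᶜ = 0)
    (n : ℕ) (a b : ℝ) (hb : 0 ≤ b) (hba : b ≤ a) (ha : a ≤ 1) :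
    FullRecall.spePayoffs μ n a b ⊆ {p | ∃ u ∈ Set.Icc (0 : ℝ) 1, p = (u, u)} ∧
    IsLeast (Prod.fst '' FullRecall.spePayoffs μ n a b) (FullRecall.low μ n a b) ∧
    IsGreatest (Prod.fst '' FullRecall.spePayoffs μ n a b) (FullRecall.high μ n a b) := by
  have ha' : a ∈ Set.Icc (0 : ℝ) 1 := ⟨hb.trans hba, ha⟩
  have hb' : b ∈ Set.Icc (0 : ℝ) 1 := ⟨hb, hba.trans ha⟩
  have hx : ∀ j, (![a, b] : Fin (0 + 2) → ℝ) j ∈ Set.Icc (0 : ℝ) 1 := fun j => by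
    fin_cases j
    · exact ha'
    · exact hb'
  have hist : FullRecall.IsHistory a b 0 ![a, b] [] := ⟨rfl, rfl, hx, rfl, trivial⟩
  have key := fun (σ : (i : Fin 2) → FullRecall.Strategy i) (hσ : FullRecall.IsSPE μ n a b σ) =>
    hσ.expectedPayoff_bounds hμ n (zero_add n) hist fun _ => rfl
  simp only [FullRecall.topTwo_initial hba,
    FullRecall.regionValue_lowPass_eq_low hμ n ha' hb',
    FullRecall.highValue_eq_high hμ n ha' hb'] at key
  refine ⟨?_, ⟨?_, ?_⟩, ⟨?_, ?_⟩⟩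
  · rintro _ ⟨σ, hσ, rfl⟩
    exact ⟨_, FullRecall.expectedPayoff_mem_Icc hμ σ n hx [] 0,
      Prod.ext rfl (key σ hσ).1.symm⟩
  · rw [← FullRecall.regionValue_lowPass_eq_low hμ n ha' hb']
    refine FullRecall.regionValue_mem_spePayoffs hμ (FullRecall.measurableSet_lowPass (μ := μ))
      (fun k a ha b hb hba h => ?_) (fun k a _ b _ _ h => not_lt.1 h) n hba hx
    -- In the low region `a` is below the waiting value, so the average of the two exceeds `a`, and
    -- joint passing is worth at least that average.
    have := FullRecall.half_add_waitValue_le_integral_regionValue hμ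
      (FullRecall.measurableSet_lowPass (μ := μ)) k ha hb hba
    rw [FullRecall.LowPass] at h
    linarith
  · rintro _ ⟨_, ⟨σ, hσ, rfl⟩, rfl⟩
    exact (key σ hσ).2.1
  · rw [← FullRecall.regionValue_highPass_eq_high hμ n ha' hb']
    refine FullRecall.regionValue_mem_spePayoffs hμ (FullRecall.measurableSet_highPass (μ := μ))
      (fun k a ha b hb hba h => ?_) (fun k a _ b _ _ h => ?_) n hba hx
    · have := FullRecall.half_add_waitValue_le_integral_regionValue hμ
        (FullRecall.measurableSet_highPass (μ := μ)) k ha hb hba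
      rw [FullRecall.HighPass] at h
      simp only [FullRecall.regionValue_highPass] at this ⊢
      -- Either `a` is at most the waiting value, and the tie bound gives the claim as in the low
      -- region, or `a` is at most the continuation value directly.
      rcases le_max_iff.1 h with h | h <;> linarith
    · exact ((le_max_left _ _).trans_lt (not_le.1 h)).le
  · rintro _ ⟨_, ⟨σ, hσ, rfl⟩, rfl⟩
    exact (key σ hσ).2.2
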